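/- Let $M$ be a matroid on a finite ground set $E$ with rank function $\mathrm{rk}$, closure operator $\mathrm{cl}$ and lattice of flats $\mathcal L$. A set $\mathscr G \subseteq \mathcal L\setminus\{\mathrm{cl}(\emptyset)\}$ is a building set if for every flat $X \neq \mathrm{cl}(\emptyset)$, writing $\mathrm{fact}_{\mathscr G}(X) = \{G_1,\dots,G_k\}$ for the set of maximal elements of $\{G\in\mathscr G : G\subseteq X\}$, there is an isomorphism of posets $\varphi_X\colon \prod_{i=1}^k[\mathrm{cl}(\emptyset),G_i]\to[\mathrm{cl}(\emptyset),X]$ with $\varphi_X(\mathrm{cl}(\emptyset),\dots,G_i,\dots,\mathrm{cl}(\emptyset))=G_i$ for all $i$. A subset $\mathcal S\subseteq\mathscr G$ is nested if the join of any at least two pairwise incomparable elements of $\mathcal S$ is not in $\mathscr G$; let $\mathcal N(M,\mathscr G)$ be the set of nested sets. For nested $\mathcal S$ and $F\in\mathcal S$ let $z_{\mathcal S}(F)$ be the join of all elements of $\mathcal S$ properly contained in $F$. Let $M_{\mathcal S}$ be the matroid on $E$ whose bases are the bases $B$ of $M$ that maximize $\sum_{e\in B}w_e$, where $w=\sum_{F\in\mathcal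 S}v_F$ is the sum of the indicator vectors of the members of $\mathcal S$ (any other point $w$ of the relative interior of the cone spanned by the $v_F$, $F \in \mathcal S$, gives the same matroid). Let $\chi_N(q)=\sum_{S\subseteq E}(-1)^{\#S}q^{\mathrm{rk}N-\mathrm{rk}_N S}$ be the characteristic polynomial of a matroid $N$ on $E$, and $[n]_q=1+q+\dots+q^{n-1}$. For $\mathcal S\in\mathcal N(M,\mathscr G)$ define $$P_{M,\mathscr G}^{\mathcal S}(q)=\sum_{\substack{\mathcal T\in\mathcal N(M,\mathscr G)\\ \mathcal T\supseteq\mathcal S}}\frac{\chi_{M_{\mathcal T}}(q)}{(q-1)^{\#\mathcal T}},$$ $$H_{M,\mathscr G}^{\mathcal S}(q)=q^{\#(\mathrm{fact}_{\mathscr G}(E)\setminus\mathcal S)}\sum_{\substack{\mathcal T\in\mathcal N(M,\mathscr G)\\ \mathcal T\cup\mathcal S'\in\mathcal N(M,\mathscr G)}}\ \prod_{F\in\mathcal T}\Bigl([\mathrm{rk}F-\mathrm{rk}\,z_{\mathcal T\cup\mathcal S'}(F)]_q-1\Bigr),\qquad \mathcal S'=\mathcal S\cup\mathrm{fact}_{\mathscr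 G}(E).$$ (1) If $M$ is loopless, then for every building set $\mathscr G$ and every nested set $\mathcal S\in\mathcal N(M,\mathscr G)$, $$P_{M,\mathscr G}^{\mathcal S}(q)=H_{M,\mathscr G}^{\mathcal S}(q);$$ in particular the rational function $P_{M,\mathscr G}^{\mathcal S}(q)$ is a polynomial with integer coefficients. (2) If $M$ is simple, then van der Veer's topological zeta function $$Z_{\mathcal L,\mathscr G}(s)=\sum_{\mathcal S\in\mathcal N(M,\mathscr G)}\ \sum_{\substack{\mathcal T\in\mathcal N(M,\mathscr G)\\ \mathcal T\supseteq\mathcal S}}(-1)^{\#\mathcal T-\#\mathcal S}H_{M,\mathscr G}^{\mathcal T}(1)\prod_{F\in\mathcal S}\frac{1}{(\#F)s+\mathrm{rk}F}\in\mathbb Q(s)$$ does not depend on the choice of the building set $\mathscr G$. -/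

import Mathlib

open Polynomial

noncomputable section

namespace MatroidBuilding

variable {α : Type*}

/-- The rank `rk_M X` as a natural number (for matroids on a finite ground set). -/
def rk (M : Matroid α) (X : Set α) : ℕ := (M.eRk X).toNat

/-- A matroid is simple if it has no loops and no two parallel elements: every set of at most two
elements of the ground set is independent. -/
def IsSimple (M : Matroid α) : Prop :=
  ∀ e ∈ M.E, ∀ f ∈ M.E, M.Indep {e, f}

/-- The weight `∑_{e ∈ B} w_e` of a (finite) set `B`. -/
def weight (w : α → ℝ) (B : Set α) : ℝ := ∑ᶠ e ∈ B, w e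

/-- `B` is a basis of `M` of maximum `w`-weight. -/
def IsMaxWeightBase (M : Matroid α) (w : α → ℝ) (B : Set α) : Prop :=
  M.IsBase B ∧ ∀ B', M.IsBase B' → weight w B' ≤ weight w B

theorem exists_isMaxWeightBase (M : Matroid α) [M.Finite] (w : α → ℝ) :
    ∃ B, IsMaxWeightBase M w B := by
  have hfin : {B | M.IsBase B}.Finite :=
    M.ground_finite.finite_subsets.subset fun B hB => Matroid.IsBase.subset_ground hB
  obtain ⟨B, hB, hmax⟩ := hfin.exists_maximalFor (weight w) _ M.exists_isBase
  refine ⟨B, hB, fun B' hB' => ?_⟩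
  rcases le_total (weight w B') (weight w B) with h | h
  · exact h
  · exact hmax hB' h

/-- Symmetric basis exchange. -/
theorem symm_exchange {M : Matroid α} {B₁ B₂ : Set α} (h₁ : M.IsBase B₁) (h₂ : M.IsBase B₂)
    {e : α} (he : e ∈ B₁ \ B₂) :
    ∃ f ∈ B₂ \ B₁, M.IsBase (insert f (B₁ \ {e})) ∧ M.IsBase (insert e (B₂ \ {f})) := by
  have heE : e ∈ M.E := h₁.subset_ground he.1
  have hC := h₂.fundCircuit_isCircuit heE he.2
  have hK := Matroid.fundCocircuit_isCocircuit he.1 h₁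
  have hnt := hC.isCocircuit_inter_nontrivial hK
    ⟨e, M.mem_fundCircuit e B₂, M.mem_fundCocircuit e B₁⟩
  obtain ⟨f, ⟨hfC, hfK⟩, hfe⟩ := hnt.exists_ne e
  have hf2 : f ∈ B₂ := (M.fundCircuit_subset_insert e B₂ hfC).resolve_left hfe
  have hf1 : f ∉ B₁ := ((M.fundCocircuit_subset_insert_compl e B₁ hfK).resolve_left hfe).2
  have hfE : f ∈ M.E := h₂.subset_ground hf2
  refine ⟨f, ⟨hf2, hf1⟩, ?_, ?_⟩
  · have hfC1 : e ∈ M.fundCircuit f B₁ := h₁.mem_fundCocircuit_iff_mem_fundCircuit.1 hfK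
    have hi := (h₁.indep.mem_fundCircuit_iff (by rw [h₁.closure_eq]; exact hfE) hf1).1 hfC1
    rw [Set.insert_sdiff_singleton_comm hfe]
    exact h₁.exchange_isBase_of_indep' he.1 hf1 hi
  · have hi := (h₂.indep.mem_fundCircuit_iff (by rw [h₂.closure_eq]; exact heE) he.2).1 hfC
    rw [Set.insert_sdiff_singleton_comm (Ne.symm hfe)]
    exact h₂.exchange_isBase_of_indep' hf2 he.2 hi

theorem weight_insert_diff (w : α → ℝ) {B : Set α} (hB : B.Finite) {e f : α} (he : e ∈ B)
    (hf : f ∉ B) : weight w (insert f (B \ {e})) + w e = weight w B + w f := by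
  have h1 : weight w (insert f (B \ {e})) = w f + weight w (B \ {e}) :=
    finsum_mem_insert _ (fun h => hf h.1) hB.sdiff
  have h2 : weight w B = w e + weight w (B \ {e}) := by
    conv_lhs => rw [← Set.insert_sdiff_self_of_mem he]
    exact finsum_mem_insert _ (fun h => h.2 rfl) hB.sdiff
  rw [h1, h2]; ring

theorem isMaxWeightBase_exchange (M : Matroid α) [M.Finite] (w : α → ℝ) :
    Matroid.ExchangeProperty (IsMaxWeightBase M w) := by
  intro B₁ B₂ h₁ h₂ e he
  obtain ⟨f, hf, hb₁, hb₂⟩ := symm_exchange h₁.1 h₂.1 he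
  have e₁ := weight_insert_diff w (h₁.1.finite) he.1 hf.2
  have e₂ := weight_insert_diff w (h₂.1.finite) hf.1 he.2
  have l₁ := h₁.2 _ hb₁
  have l₂ := h₂.2 _ hb₂
  exact ⟨f, hf, hb₁, fun B' hB' => (h₁.2 B' hB').trans (by linarith)⟩

/-- The matroid `M_w`, on the same ground set as `M`, whose bases are the bases of `M` of maximum
`w`-weight. -/
def initial (M : Matroid α) [M.Finite] (w : α → ℝ) : Matroid α :=
  Matroid.ofIsBaseOfFinite M.ground_finite (IsMaxWeightBase M w) (exists_isMaxWeightBase M w)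
    (isMaxWeightBase_exchange M w) fun _ h => h.1.subset_ground

instance (M : Matroid α) [M.Finite] (w : α → ℝ) : (initial M w).Finite :=
  ⟨M.ground_finite⟩

/-- The sum `∑_{F ∈ S} v_F` of the indicator vectors of the members of `S`; it is a point of the
relative interior of the cone `σ_S` spanned by these vectors. -/
def coneVector (S : Finset (Set α)) : α → ℝ :=
  ∑ F ∈ S, F.indicator (fun _ => (1 : ℝ))

/-- The matroid `M_S`, that is, `M_w` for `w` in the relative interior of `σ_S`. -/
def initialAt (M : Matroid α) [M.Finite] (S : Finset (Set α)) : Matroid α :=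
  initial M (coneVector S)

instance (M : Matroid α) [M.Finite] (S : Finset (Set α)) : (initialAt M S).Finite :=
  inferInstanceAs (initial M (coneVector S)).Finite

/-- The characteristic polynomial `χ_M(q) = ∑_{S ⊆ E} (-1)^{#S} q^{rk M - rk S}`. -/
def charPoly (M : Matroid α) [M.Finite] : ℤ[X] :=
  ∑ S ∈ M.ground_finite.toFinset.powerset, (-1) ^ S.card * X ^ (rk M M.E - rk M (S : Set α))

/-- The finite set of flats of `M`. -/
def flats (M : Matroid α) [M.Finite] : Finset (Set α) :=
  (M.ground_finite.finite_subsets.subset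
    (fun F (hF : F ∈ {F | M.IsFlat F}) => hF.subset_ground)).toFinset

/-- The interval `[A, B]` in the lattice of flats of `M`, ordered by inclusion. -/
abbrev FlatInterval (M : Matroid α) (A B : Set α) : Type _ :=
  {F : Set α // M.IsFlat F ∧ A ⊆ F ∧ F ⊆ B}

/-- `max G_{≤ X}`: the maximal elements among the members of `G` contained in `X`. -/
def factors (G : Set (Set α)) (X : Set α) : Set (Set α) :=
  {A | Maximal (fun Y => Y ∈ G ∧ Y ⊆ X) A}

/-- `G` is a building set in the lattice of flats of `M`: it consists of flats different from
`cl(∅)`, and for every flat `X ≠ cl(∅)` with `factors G X = {G₁, …, G_k}` there is an isomorphism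
of posets `∏ᵢ [cl(∅), Gᵢ] ≃ [cl(∅), X]` sending `(cl(∅), …, Gᵢ, …, cl(∅))` to `Gᵢ` for all `i`. -/
def IsBuildingSet (M : Matroid α) (G : Set (Set α)) : Prop :=
  (∀ F ∈ G, M.IsFlat F ∧ F ≠ M.closure ∅) ∧
  ∀ X : Set α, M.IsFlat X → X ≠ M.closure ∅ →
    ∃ φ : ((A : factors G X) → FlatInterval M (M.closure ∅) A.1) ≃o
        FlatInterval M (M.closure ∅) X,
      ∀ (A : factors G X) (v : (A : factors G X) → FlatInterval M (M.closure ∅) A.1),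
        (v A).1 = A.1 → (∀ B, B ≠ A → (v B).1 = M.closure ∅) → (φ v).1 = A.1

/-- The join (in the lattice of flats) of a family of flats. -/
def join (M : Matroid α) (A : Set (Set α)) : Set α := M.closure (⋃₀ A)

/-- `S ⊆ G` is nested: the join of any at least two pairwise incomparable members of `S` is not
in `G`. -/
def IsNested (M : Matroid α) (G : Set (Set α)) (S : Finset (Set α)) : Prop :=
  (S : Set (Set α)) ⊆ G ∧
  ∀ A ⊆ S, 2 ≤ A.card → IsAntichain (· ⊆ ·) (A : Set (Set α)) → join M A ∉ G

open Classical in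
/-- The nested set complex `N(M, G)`, as the finite set of its faces. -/
def nestedSets (M : Matroid α) [M.Finite] (G : Set (Set α)) : Finset (Finset (Set α)) :=
  (flats M).powerset.filter (IsNested M G)

/-- `z_S(F)`, the join of the members of `S` properly contained in `F`. -/
def z (M : Matroid α) (S : Finset (Set α)) (F : Set α) : Set α :=
  join M {A | A ∈ S ∧ A ⊂ F}

open Classical in
/-- `fact_G(E)` as a finite set, where `E` is the ground set of `M`. -/
def topFactors (M : Matroid α) [M.Finite] (G : Set (Set α)) : Finset (Set α) :=
  (flats M).filter (· ∈ factors G M.E)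

/-- The `q`-analogue `[n]_q = 1 + q + ⋯ + q^{n-1}`. -/
def qNat (n : ℕ) : ℤ[X] := ∑ i ∈ Finset.range n, X ^ i

open Classical in
/-- The `G`-Euler-Poincaré polynomial `P_{M,G}^S(q)` of `M` at `S`, computed in the fraction field
of `ℤ[q]`. -/
def eulerPoincare (M : Matroid α) [M.Finite] (G : Set (Set α)) (S : Finset (Set α)) :
    RatFunc ℤ :=
  ∑ T ∈ (nestedSets M G).filter (S ⊆ ·),
    algebraMap ℤ[X] (RatFunc ℤ) (charPoly (initialAt M T)) / (RatFunc.X - 1) ^ T.card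

open Classical in
/-- `∑_T ∏_{F ∈ T} ([rk F - rk z_{T ∪ S}(F)]_q - 1)`, over the nested `T` with `T ∪ S` nested. -/
def hilbertSum (M : Matroid α) [M.Finite] (G : Set (Set α)) (S : Finset (Set α)) : ℤ[X] :=
  ∑ T ∈ (nestedSets M G).filter (fun T => T ∪ S ∈ nestedSets M G),
    ∏ F ∈ T, (qNat (rk M F - rk M (z M (T ∪ S) F)) - 1)

open Classical in
/-- The polynomial `H_{M,G}^S(q)`. If `fact_G(E) ⊆ S`, this is `hilbertSum M G S`. -/
def hPoly (M : Matroid α) [M.Finite] (G : Set (Set α)) (S : Finset (Set α)) : ℤ[X] :=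
  X ^ (topFactors M G \ S).card * hilbertSum M G (S ∪ topFactors M G)

open Classical in
/-- Van der Veer's topological zeta function (a rational function of `s` over `ℚ`) of the lattice
of flats of a simple matroid `M` with respect to the building set `G`. -/
def topZeta (M : Matroid α) [M.Finite] (G : Set (Set α)) : RatFunc ℚ :=
  ∑ S ∈ nestedSets M G, ∑ T ∈ (nestedSets M G).filter (S ⊆ ·),
    (-1) ^ (T.card - S.card) * (((hPoly M G T).eval 1 : ℤ) : RatFunc ℚ) *
      ∏ F ∈ S, (1 / ((F.ncard : RatFunc ℚ) * RatFunc.X + (rk M F : RatFunc ℚ)))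

end MatroidBuilding

end

set_option linter.unusedSectionVars false

/-! In a loopless matroid the bottom flat is empty, and the isomorphisms of a building set amount to
something concrete: every flat is the disjoint union of its factors, and their ranks add up
(`IsBuildingSet.isFactorial`). Only this is used afterwards. It implies that the factors of the join
of a nested set are its maximal members (`IsFactorial.factors_join`).

Part (1). The bases of `M_T` are the bases `B` of `M` with `#(B ∩ F) = rk F` for all `F ∈ T`. If `T`
contains the factors of `E`, the cells `F \ z_T(F)` partition `E` and `M_T` is the direct sum of the
minors `(M | F) / z_T(F)`, so its characteristic polynomial is the product of theirs
(`IsFactorial.charPoly_initialAt`). On the other side, Möbius inversion in the lattice of flats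
writes `[rk F - rk Y]_q` as the sum of the reduced characteristic polynomials of `(M | F) / Z` over
the flats `Y ⊆ Z ⊂ F` (`algebraMap_qNat`). Expanding `H` in this way and exchanging sums leaves, for
each nested `W` and each choice of flats `p F ⊂ F`, a signed count of the nested `U ⊇ W` with
`z_U(F) ⊆ p F`. Toggling a factor of some `p F` cancels this count unless `p = z_W`
(`IsFactorial.sum_refinements`), and what survives is the sum that defines `P`. Adding factors of
`E` to `T` does not change `M_T`; those outside `S` account for the power of `q`.

Part (2). Inverting (1) over the nested set complex, the alternating sum of `H` over the nested sets
containing `S` is `χ_{M_S}(q) / (q-1)^{#S}` (`IsFactorial.altH_mul`). Every `G` is then compared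
with the building set of all nonempty flats, whose nested sets are flags. A flag `c` has a carrier,
the nested set of all factors of its members, and both give the same initial matroid. The two
quotients thus differ by a power of `q-1`, and at `q = 1` only the flags as large as their carrier
survive (`IsFactorial.eval_altH_flag`). These flags subdivide the cone of the carrier, and since `#F
s + rk F` is additive over factors, their products of reciprocals add up to the product over the
carrier (`IsFactorial.sum_flags`). -/

namespace MatroidBuilding

variable {α : Type*} {M : Matroid α} [M.Finite] {G : Set (Set α)} {X Y F A : Set α}
  {T U S W c : Finset (Set α)}

/-! ### Ranks as natural numbers, flats and joins. -/

section Rank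

theorem cast_rk (M : Matroid α) [M.Finite] (X : Set α) : (rk M X : ℕ∞) = M.eRk X :=
  ENat.natCast_toNat (Matroid.eRk_ne_top_iff.2 (M.isRkFinite_set X))

theorem rk_mono (M : Matroid α) [M.Finite] (h : X ⊆ Y) : rk M X ≤ rk M Y := by
  have := M.eRk_mono h
  simp only [← cast_rk] at this
  exact_mod_cast this

theorem rk_closure (X : Set α) : rk M (M.closure X) = rk M X := by
  simp [rk, Matroid.eRk_closure_eq]

theorem rk_empty (M : Matroid α) : rk M ∅ = 0 := by simp [rk]

theorem rk_inter_add_rk_union_le (M : Matroid α) [M.Finite] (X Y : Set α) :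
    rk M (X ∩ Y) + rk M (X ∪ Y) ≤ rk M X + rk M Y := by
  have := M.eRk_inter_add_eRk_union_le X Y
  simp only [← cast_rk] at this
  exact_mod_cast this

theorem rk_union_le (M : Matroid α) [M.Finite] (X Y : Set α) :
    rk M (X ∪ Y) ≤ rk M X + rk M Y :=
  le_trans (Nat.le_add_left _ _) (rk_inter_add_rk_union_le M X Y)

theorem rk_sUnion_le (M : Matroid α) [M.Finite] (S : Finset (Set α)) :
    rk M (⋃₀ (S : Set (Set α))) ≤ ∑ A ∈ S, rk M A := by
  classical
  induction S using Finset.induction_on with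
  | empty => simp [rk_empty]
  | insert a s ha ih =>
    rw [Finset.coe_insert, Set.sUnion_insert, Finset.sum_insert ha]
    exact (rk_union_le M _ _).trans (by omega)

theorem rk_of_indep {I : Set α} (hI : M.Indep I) : rk M I = I.ncard := by
  rw [rk, hI.eRk_eq_encard]; rfl

theorem ncard_le_rk {I : Set α} (hI : M.Indep I) (h : I ⊆ X) : I.ncard ≤ rk M X :=
  rk_of_indep hI ▸ rk_mono M h

theorem ncard_basis {I : Set α} (hI : M.IsBasis I X) : I.ncard = rk M X := by
  rw [← rk_of_indep hI.indep, ← rk_closure I, hI.closure_eq_closure, rk_closure]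

theorem ncard_base {B : Set α} (hB : M.IsBase B) : B.ncard = rk M M.E :=
  ncard_basis hB.isBasis_ground

theorem subset_closure_of_rk_le (h : X ⊆ Y) (hY : Y ⊆ M.E) (hr : rk M Y ≤ rk M X) :
    Y ⊆ M.closure X := by
  have := (M.isRkFinite_set X).closure_eq_closure_of_subset_of_eRk_ge_eRk h
    (by simp only [← cast_rk]; exact_mod_cast hr)
  rw [this]
  exact M.subset_closure Y

theorem eq_of_rk_le (hX : M.IsFlat X) (hY : M.IsFlat Y) (h : X ⊆ Y) (hr : rk M Y ≤ rk M X) :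
    X = Y :=
  h.antisymm (hX.closure ▸ subset_closure_of_rk_le h hY.subset_ground hr)

theorem rk_lt (hX : M.IsFlat X) (hY : M.IsFlat Y) (h : X ⊂ Y) : rk M X < rk M Y := by
  by_contra hr
  exact h.ne (eq_of_rk_le hX hY h.subset (not_lt.1 hr))

theorem finite_of_subset (h : X ⊆ M.E) : X.Finite := M.ground_finite.subset h

theorem mem_flats : X ∈ flats M ↔ M.IsFlat X := by
  simp only [flats, Set.Finite.mem_toFinset, Set.mem_ofPred_eq]

theorem flat_finite : {F | M.IsFlat F}.Finite :=
  (flats M).finite_toSet.subset fun _ h => mem_flats.2 h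

theorem closure_subset_flat (hF : M.IsFlat F) (h : X ⊆ F) : M.closure X ⊆ F :=
  hF.closure ▸ M.closure_subset_closure h

theorem exists_flat_rk_add_one (hX : M.IsFlat X) (hr : rk M X ≠ 0) :
    ∃ Y, M.IsFlat Y ∧ Y ⊂ X ∧ rk M Y + 1 = rk M X := by
  obtain ⟨I, hI⟩ := M.exists_isBasis X hX.subset_ground
  have hc := ncard_basis hI
  have hfin : I.Finite := finite_of_subset hI.indep.subset_ground
  obtain ⟨e, he⟩ : I.Nonempty := by
    rw [Set.nonempty_iff_ne_empty]
    rintro rfl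
    simp at hc; omega
  have h1 : rk M (M.closure (I \ {e})) + 1 = rk M X := by
    rw [rk_closure, rk_of_indep (hI.indep.sdiff {e}), Set.ncard_sdiff_singleton_add_one he hfin, hc]
  refine ⟨M.closure (I \ {e}), M.isFlat_closure _, ?_, h1⟩
  refine (closure_subset_flat hX (Set.sdiff_subset.trans hI.subset)).ssubset_of_ne ?_
  intro h
  rw [h] at h1
  omega

theorem subset_join_of_mem {S : Set (Set α)} (hS : ∀ B ∈ S, M.IsFlat B) (hA : A ∈ S) :
    A ⊆ join M S := by
  refine (Set.subset_sUnion_of_mem hA).trans (M.subset_closure _ ?_)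
  exact Set.sUnion_subset fun B hB => (hS B hB).subset_ground

theorem isFlat_join (S : Set (Set α)) : M.IsFlat (join M S) := M.isFlat_closure _

theorem join_subset {S : Set (Set α)} (hX : M.IsFlat X) (h : ∀ A ∈ S, A ⊆ X) : join M S ⊆ X :=
  closure_subset_flat hX (Set.sUnion_subset h)

theorem join_mono {S T : Set (Set α)} (h : S ⊆ T) : join M S ⊆ join M T :=
  M.closure_subset_closure (Set.sUnion_subset_sUnion h)

end Rank

/-! ### Factors of a flat and the combinatorial form of building sets. -/

section Factors

open Classical in
/-- The factors of `X`, as a finite set of flats. -/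
noncomputable def factorFinset (M : Matroid α) [M.Finite] (G : Set (Set α)) (X : Set α) :
    Finset (Set α) :=
  (flats M).filter (· ∈ factors G X)

/-- A set of nonempty flats such that every flat `X` decomposes as the disjoint union of its
factors, with additive ranks. For loopless matroids these are the building sets. -/
structure IsFactorial (M : Matroid α) [M.Finite] (G : Set (Set α)) : Prop where
  isFlat : ∀ F ∈ G, M.IsFlat F
  nonempty : ∀ F ∈ G, F.Nonempty
  exists_mem : ∀ X, M.IsFlat X → ∀ e ∈ X, ∃ A ∈ factors G X, e ∈ A
  eq_of_mem : ∀ X, M.IsFlat X → ∀ A ∈ factors G X, ∀ B ∈ factors G X, ∀ e ∈ A, e ∈ B → A = B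
  sum_rk : ∀ X, M.IsFlat X → ∑ A ∈ factorFinset M G X, rk M A = rk M X

theorem exists_factor_of_mem (hG : ∀ F ∈ G, M.IsFlat F) (hA : A ∈ G) (h : A ⊆ X) :
    ∃ B ∈ factors G X, A ⊆ B := by
  have hfin : {Y | Y ∈ G ∧ Y ⊆ X}.Finite := flat_finite.subset fun Y hY => hG Y hY.1
  obtain ⟨B, hAB, hB⟩ := hfin.exists_le_maximal (a := A) ⟨hA, h⟩
  exact ⟨B, hB, hAB⟩

theorem factor_mem (h : A ∈ factors G X) : A ∈ G := h.1.1

theorem factor_subset (h : A ∈ factors G X) : A ⊆ X := h.1.2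

end Factors

/-! ### From product decompositions of intervals to disjoint unions with additive rank. -/

section OfIso

variable [M.Loopless]

theorem closure_empty_eq : M.closure ∅ = ∅ := M.loops_eq_empty

theorem one_le_rk (hX : X ⊆ M.E) (h : X.Nonempty) : 1 ≤ rk M X := by
  obtain ⟨e, he⟩ := h
  have : rk M {e} = 1 := by
    have := M.isNonloop_of_loopless (hX he)
    rw [rk, this.eRk_eq]; rfl
  exact this ▸ rk_mono M (Set.singleton_subset_iff.2 he)

/-- The closure of a point has rank at most one and a nonempty flat has rank at least one, so such
closures are the atoms of the lattice. -/
theorem subset_of_subset_closure_singleton {e : α} (hX : M.IsFlat X) (hne : X.Nonempty)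
    (h : X ⊆ M.closure {e}) : M.closure {e} ⊆ X := by
  rw [eq_of_rk_le hX (M.isFlat_closure {e}) h]
  rw [rk_closure]
  refine le_trans ?_ (one_le_rk hX.subset_ground hne)
  have := M.eRk_singleton_le e
  rw [← cast_rk] at this
  exact_mod_cast this

theorem IsBuildingSet.isFactorial (h : IsBuildingSet M G) : IsFactorial M G := by
  classical
  obtain ⟨hG, hφ⟩ := h
  have key : ∀ X, M.IsFlat X → (∀ e ∈ X, ∃ A ∈ factors G X, e ∈ A) ∧
      (∀ A ∈ factors G X, ∀ B ∈ factors G X, ∀ e ∈ A, e ∈ B → A = B) ∧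
      ∑ A ∈ factorFinset M G X, rk M A = rk M X := by
    intro X hX
    by_cases hX0 : X = ∅
    · subst hX0
      have h0 : ∀ A, A ∉ factors G ∅ := fun A hA => (hG A hA.1.1).2
        ((Set.subset_empty_iff.1 hA.1.2).trans closure_empty_eq.symm)
      refine ⟨by simp, fun A hA => (h0 A hA).elim, ?_⟩
      rw [rk_empty]
      exact Finset.sum_eq_zero fun A hA => (h0 A (Finset.mem_filter.1 hA).2).elim
    obtain ⟨φ, hφ⟩ := hφ X hX (by rwa [closure_empty_eq])
    have hbotflat : ∀ A : Set α, A ∈ factors G X → M.closure ∅ ⊆ A := fun A hA => by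
      simp [closure_empty_eq]
    let bot : (A : factors G X) → FlatInterval M (M.closure ∅) A.1 := fun A =>
      ⟨M.closure ∅, M.isFlat_closure ∅, subset_rfl, hbotflat A A.2⟩
    let top : (A : factors G X) → FlatInterval M (M.closure ∅) A.1 := fun A =>
      ⟨A.1, (hG A.1 A.2.1.1).1, hbotflat A A.2, subset_rfl⟩
    let s : factors G X → (A : factors G X) → FlatInterval M (M.closure ∅) A.1 := fun A =>
      Function.update bot A (top A)
    have hs : ∀ A, (φ (s A)).1 = A.1 := fun A => by
      refine hφ A (s A) (by simp [s, top]) fun B hB => ?_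
      simp [s, Function.update_of_ne hB, bot]
    have hbot : ∀ v, bot ≤ v := fun v A => (v A).2.2.1
    have hbot' : ∀ v : FlatInterval M (M.closure ∅) X, φ bot ≤ v := fun v => by
      rw [← φ.le_symm_apply]; exact hbot _
    have hφbot : (φ bot).1 = ∅ := by
      have := hbot' ⟨M.closure ∅, M.isFlat_closure ∅, subset_rfl, by simp [closure_empty_eq]⟩
      exact Set.subset_empty_iff.1 ((Subtype.coe_le_coe.2 this).trans closure_empty_eq.le)
    let at' : ∀ e ∈ X, FlatInterval M (M.closure ∅) X := fun e he =>
      ⟨M.closure {e}, M.isFlat_closure _, M.closure_subset_closure (Set.empty_subset _),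
        closure_subset_flat hX (Set.singleton_subset_iff.2 he)⟩
    -- The preimage of the atom `cl {e}` has a coordinate `A` above the bottom. Keeping only this
    -- coordinate gives a nonempty flat below `cl {e}`, hence containing it, and below the image `A`
    -- of `s A`.
    have hcov : ∀ e ∈ X, ∃ A ∈ factors G X, e ∈ A := by
      intro e he
      have heE := hX.subset_ground he
      set v := φ.symm (at' e he) with hv
      have hvne : v ≠ bot := fun h => by
        have h1 : φ v = at' e he := by simp [hv]
        rw [h] at h1
        have h2 : M.closure {e} = ∅ := (congrArg Subtype.val h1).symm.trans hφbot
        exact (h2 ▸ M.mem_closure_self e heE : e ∈ (∅ : Set α))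
      obtain ⟨A, hA⟩ := Function.ne_iff.1 hvne
      refine ⟨A.1, A.2, ?_⟩
      let u := Function.update bot A (v A)
      have huv : u ≤ v := by
        intro B
        by_cases hBA : B = A
        · subst hBA; simp [u]
        · simp only [u, Function.update_of_ne hBA]; exact hbot v B
      have hus : u ≤ s A := by
        intro B
        by_cases hBA : B = A
        · subst hBA
          simp only [u, s, Function.update_self]
          exact (v B).2.2.2
        · simp [u, s, Function.update_of_ne hBA]
      have hune : u ≠ bot := fun h => hA (by rw [← h]; simp [u])
      have h1 : (φ u).1 ⊆ M.closure {e} := by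
        have := φ.monotone huv
        rw [hv, φ.apply_symm_apply] at this
        exact this
      have h2 : (φ u).1.Nonempty := by
        rw [Set.nonempty_iff_ne_empty]
        intro h
        exact hune (φ.injective (Subtype.ext (h.trans hφbot.symm)))
      have h3 := subset_of_subset_closure_singleton (φ u).2.1 h2 h1
      have h4 : (φ u).1 ⊆ A.1 := hs A ▸ (φ.monotone hus)
      exact h4 (h3 (M.mem_closure_self e heE))
    refine ⟨hcov, fun A hA B hB e heA heB => ?_, ?_⟩
    -- If `e` lay in two factors, the preimage of `cl {e}` would be below both `s A` and `s B`,
    -- which have different supports. It would be the bottom, against looplessness.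
    · by_contra hAB
      have he := hA.1.2 heA
      have h1 : ∀ C : factors G X, e ∈ C.1 → φ.symm (at' e he) ≤ s C := fun C hC => by
        rw [φ.symm_apply_le, ← Subtype.coe_le_coe, hs]
        exact closure_subset_flat (hG C.1 C.2.1.1).1 (Set.singleton_subset_iff.2 hC)
      have h2 : φ.symm (at' e he) = bot := by
        refine le_antisymm (fun C => ?_) (hbot _)
        by_cases hC : C = ⟨A, hA⟩
        · have := h1 ⟨B, hB⟩ heB C
          rwa [show s ⟨B, hB⟩ C = bot C from Function.update_of_ne
            (fun h => hAB (congrArg Subtype.val (hC.symm.trans h))) _ _] at this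
        · have := h1 ⟨A, hA⟩ heA C
          rwa [show s ⟨A, hA⟩ C = bot C from Function.update_of_ne hC _ _] at this
      have h3 : M.closure {e} = ∅ := by
        rw [← hφbot, ← h2, φ.apply_symm_apply]
      exact (h3 ▸ M.mem_closure_self e (hX.subset_ground he) : e ∈ (∅ : Set α))
    · have hmem : ∀ A, A ∈ factorFinset M G X ↔ A ∈ factors G X := fun A => by
        simp only [factorFinset, Finset.mem_filter, mem_flats, and_iff_right_iff_imp]
        exact fun hA => (hG A hA.1.1).1
      have : Fintype (factors G X) := Fintype.ofFinset (factorFinset M G X) hmem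
      have hsum : ∑ A ∈ factorFinset M G X, rk M A = ∑ A : factors G X, rk M A.1 :=
        Finset.sum_subtype _ hmem _
      apply le_antisymm
      · rw [hsum]
        -- Lowering one coordinate by one rank strictly lowers the image under `φ`, so the rank of
        -- `φ v` is at least the total rank of `v`. The bound is applied to the top element.
        have hle : ∀ n, ∀ v : (A : factors G X) → FlatInterval M (M.closure ∅) A.1,
            ∑ A, rk M (v A).1 = n → n ≤ rk M (φ v).1 := by
          intro n
          induction n with
          | zero => simp
          | succ n ih =>
            intro v hv
            obtain ⟨A, -, hA⟩ : ∃ A ∈ Finset.univ, rk M (v A).1 ≠ 0 := by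
              apply Finset.exists_ne_zero_of_sum_ne_zero (by omega)
            obtain ⟨Y, hY, hYv, hr⟩ := exists_flat_rk_add_one (v A).2.1 hA
            let w : (A : factors G X) → FlatInterval M (M.closure ∅) A.1 :=
              Function.update v A ⟨Y, hY, by simp [closure_empty_eq], hYv.subset.trans (v A).2.2.2⟩
            have hwv : w < v := by
              refine Pi.lt_def.2 ⟨fun B => ?_, A, ?_⟩
              · by_cases hB : B = A
                · subst hB
                  simp only [w, Function.update_self]
                  exact hYv.subset
                · simp [w, Function.update_of_ne hB]
              · simp only [w, Function.update_self]
                exact Subtype.coe_lt_coe.1 hYv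
            have h1 : ∑ B, rk M (w B).1 = n := by
              rw [← Finset.add_sum_erase _ _ (Finset.mem_univ A)] at hv ⊢
              rw [Finset.sum_congr rfl (g := fun B => rk M (v B).1)]
              · simp only [w, Function.update_self]; omega
              · intro B hB
                simp only [w, Function.update_of_ne (Finset.ne_of_mem_erase hB)]
            have h2 := ih w h1
            have h3 : (φ w).1 ⊂ (φ v).1 := Subtype.coe_lt_coe.2 (φ.strictMono hwv)
            have := rk_lt (φ w).2.1 (φ v).2.1 h3
            omega
        exact (hle _ top rfl).trans (rk_mono M (φ top).2.2.2)
      · refine le_trans (rk_mono M ?_) (rk_sUnion_le M (factorFinset M G X))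
        intro e he
        obtain ⟨A, hA, heA⟩ := hcov e he
        exact ⟨A, (hmem A).2 hA, heA⟩
  exact ⟨fun F hF => (hG F hF).1, fun F hF => Set.nonempty_iff_ne_empty.2
    fun h => (hG F hF).2 (h.trans closure_empty_eq.symm), fun X hX => (key X hX).1,
    fun X hX => (key X hX).2.1, fun X hX => (key X hX).2.2⟩

end OfIso

/-! ### Nested sets and the factors of their joins. -/

section Nested

theorem IsNested.subset (hT : IsNested M G T) (h : S ⊆ T) : IsNested M G S :=
  ⟨(Finset.coe_subset.2 h).trans hT.1, fun A hA => hT.2 A (hA.trans h)⟩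

theorem mem_nestedSets (hG : IsFactorial M G) : T ∈ nestedSets M G ↔ IsNested M G T := by
  simp only [nestedSets, Finset.mem_filter, Finset.mem_powerset, and_iff_right_iff_imp]
  exact fun h F hF => mem_flats.2 (hG.isFlat F (h.1 hF))

theorem mem_factorFinset (hG : IsFactorial M G) : A ∈ factorFinset M G X ↔ A ∈ factors G X := by
  simp only [factorFinset, Finset.mem_filter, mem_flats, and_iff_right_iff_imp]
  exact fun hA => hG.isFlat A (factor_mem hA)

/-- The inclusion-maximal members of `T`. -/
noncomputable def maxes (T : Finset (Set α)) : Finset (Set α) := by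
  classical exact T.filter fun A => ∀ B ∈ T, A ⊆ B → A = B

theorem mem_maxes : A ∈ maxes T ↔ A ∈ T ∧ ∀ B ∈ T, A ⊆ B → A = B := by
  simp [maxes]

theorem maxes_subset (T : Finset (Set α)) : maxes T ⊆ T := fun _ h => (mem_maxes.1 h).1

theorem isAntichain_maxes (T : Finset (Set α)) :
    IsAntichain (· ⊆ ·) (maxes T : Set (Set α)) := fun _ hA B hB hne h =>
  hne ((mem_maxes.1 hA).2 B (maxes_subset T hB) h)

theorem exists_mem_maxes (hA : A ∈ T) : ∃ B ∈ maxes T, A ⊆ B := by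
  obtain ⟨B, hAB, hB⟩ := T.exists_le_maximal hA
  exact ⟨B, mem_maxes.2 ⟨hB.1, fun C hC h => h.antisymm (hB.2 hC h)⟩, hAB⟩

theorem sUnion_maxes (T : Finset (Set α)) :
    ⋃₀ (maxes T : Set (Set α)) = ⋃₀ (T : Set (Set α)) := by
  refine (Set.sUnion_subset_sUnion (Finset.coe_subset.2 (maxes_subset T))).antisymm ?_
  refine Set.sUnion_subset fun A hA => ?_
  obtain ⟨B, hB, hAB⟩ := exists_mem_maxes hA
  exact hAB.trans (Set.subset_sUnion_of_mem hB)

theorem join_maxes (T : Finset (Set α)) : join M (maxes T : Set (Set α)) = join M T := by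
  rw [join, sUnion_maxes, join]

theorem join_eq_of_top_mem (hF : M.IsFlat F) (h : F ∈ T) (hT : ∀ A ∈ T, A ⊆ F) :
    join M (T : Set (Set α)) = F := by
  have : ⋃₀ (T : Set (Set α)) = F :=
    (Set.sUnion_subset hT).antisymm (Set.subset_sUnion_of_mem h)
  rw [join, this, hF.closure]

namespace IsFactorial

variable [M.Loopless] (hG : IsFactorial M G)
include hG

theorem eq_of_inter_nonempty {B : Set α} (hX : M.IsFlat X) (hA : A ∈ factors G X)
    (hB : B ∈ factors G X) (h : (A ∩ B).Nonempty) : A = B := by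
  obtain ⟨e, he⟩ := h
  exact hG.eq_of_mem X hX A hA B hB e he.1 he.2

/-- Members of `G` meeting a factor of `X` inside `X` are contained in that factor. -/
theorem subset_factor {B : Set α} (hX : M.IsFlat X) (hA : A ∈ factors G X) (hB : B ∈ G)
    (hBX : B ⊆ X) (h : (A ∩ B).Nonempty) : B ⊆ A := by
  obtain ⟨C, hC, hBC⟩ := exists_factor_of_mem hG.isFlat hB hBX
  rwa [hG.eq_of_inter_nonempty hX hA hC (h.mono (Set.inter_subset_inter_right _ hBC))]

/-- All members of `S` meet `A`, so they fall into the factor of the join that contains `A`; the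
join is therefore that factor. -/
theorem join_mem {S : Set (Set α)} (hS : S ⊆ G) (hA : A ∈ S)
    (h : ∀ B ∈ S, (A ∩ B).Nonempty) : join M S ∈ G := by
  have hfl : ∀ B ∈ S, M.IsFlat B := fun B hB => hG.isFlat B (hS hB)
  obtain ⟨C, hC, hAC⟩ := exists_factor_of_mem (X := join M S) hG.isFlat (hS hA)
    (subset_join_of_mem hfl hA)
  have : join M S ⊆ C := join_subset (hG.isFlat C (factor_mem hC)) fun B hB =>
    hG.subset_factor (isFlat_join S) hC (hS hB) (subset_join_of_mem hfl hB)
      ((h B hB).mono (Set.inter_subset_inter_left _ hAC))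
  rw [this.antisymm (factor_subset hC)]
  exact factor_mem hC

theorem flat_of_nested (hT : IsNested M G T) (hA : A ∈ T) : M.IsFlat A :=
  hG.isFlat A (hT.1 hA)

theorem subset_join (hT : IsNested M G T) (hA : A ∈ T) : A ⊆ join M (T : Set (Set α)) :=
  subset_join_of_mem (fun _ hB => hG.flat_of_nested hT hB) hA

/-- Two incomparable members that meet would have their join in `G` by `join_mem`. -/
theorem subset_or_subset {B : Set α} (hT : IsNested M G T) (hA : A ∈ T) (hB : B ∈ T)
    (h : (A ∩ B).Nonempty) : A ⊆ B ∨ B ⊆ A := by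
  classical
  by_contra! hc
  have hne : A ≠ B := fun h => hc.1 h.subset
  refine hT.2 {A, B} ?_ (Finset.card_pair hne).ge ?_ ?_
  · simp [Finset.insert_subset_iff, hA, hB]
  · simp only [Finset.coe_insert, Finset.coe_singleton]
    intro C hC D hD hne
    simp only [Set.mem_insert_iff, Set.mem_singleton_iff] at hC hD
    rcases hC with h1 | h1 <;> rcases hD with h2 | h2 <;> intro h <;> simp only [h1, h2] at h hne
    exacts [hne rfl, hc.1 h, hc.2 h, hne rfl]
  · refine hG.join_mem (A := A) ?_ (by simp) ?_
    · simp [Set.insert_subset_iff, hT.1 hA, hT.1 hB]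
    · have := hG.nonempty A (hT.1 hA)
      simp [h, this]

theorem factors_join (hT : IsNested M G T) :
    factors G (join M (T : Set (Set α))) = (maxes T : Set (Set α)) := by
  classical
  set X := join M (T : Set (Set α)) with hXdef
  have hX : M.IsFlat X := isFlat_join _
  have hmax : ∀ A ∈ maxes T, A ∈ G := fun A hA => hT.1 (maxes_subset T hA)
  have hmX : ∀ A ∈ maxes T, A ⊆ X := fun A hA => hG.subset_join hT (maxes_subset T hA)
  -- `J C` collects the maximal members of `T` inside the factor `C`. These joins together span `X`,
  -- while `J C ⊆ C` and the ranks of the factors add up to `rk X`, which forces `J C = C`.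
  let J : Set α → Set α := fun C =>
    join M ((maxes T).filter (· ⊆ C) : Finset (Set α))
  have hJC : ∀ C ∈ factors G X, J C ⊆ C := fun C hC =>
    join_subset (hG.isFlat C (factor_mem hC)) fun A hA =>
      (Finset.mem_filter.1 (Finset.mem_coe.1 hA)).2
  have hcov : rk M X ≤ ∑ C ∈ factorFinset M G X, rk M (J C) := by
    have h1 : join M ((factorFinset M G X).image J : Set (Set α)) = X := by
      refine (join_subset hX ?_).antisymm ?_
      · simp only [Finset.coe_image, Set.mem_image, Finset.mem_coe, forall_exists_index, and_imp]
        rintro A C hC rfl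
        rw [mem_factorFinset hG] at hC
        exact (hJC C hC).trans (factor_subset hC)
      · refine (join_maxes (M := M) T).symm.subset.trans ?_
        refine join_subset (isFlat_join _) fun A hA => ?_
        obtain ⟨C, hC, hAC⟩ := exists_factor_of_mem hG.isFlat (hmax A hA) (hmX A hA)
        have h2 : J C ⊆ join M ((factorFinset M G X).image J : Set (Set α)) := by
          refine subset_join_of_mem ?_ ?_
          · simp only [Finset.coe_image, Set.mem_image, Finset.mem_coe, forall_exists_index,
              and_imp]
            rintro B C hC rfl
            exact isFlat_join _
          · exact Finset.mem_coe.2 (Finset.mem_image_of_mem J ((mem_factorFinset hG).2 hC))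
        refine Set.Subset.trans ?_ h2
        refine subset_join_of_mem (fun B hB => ?_) ?_
        · exact hG.isFlat B (hmax B (Finset.mem_filter.1 (Finset.mem_coe.1 hB)).1)
        · exact Finset.mem_coe.2 (Finset.mem_filter.2 ⟨hA, hAC⟩)
    have h2 : rk M X = rk M (⋃₀ ((factorFinset M G X).image J : Set (Set α))) := by
      conv_lhs => rw [← h1, join, rk_closure]
    rw [h2]
    refine (rk_sUnion_le M _).trans ?_
    exact Finset.sum_image_le_of_nonneg (fun _ _ => Nat.zero_le _)
  have hrk : ∀ C ∈ factors G X, rk M (J C) = rk M C := by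
    have h1 : ∀ C ∈ factorFinset M G X, rk M (J C) ≤ rk M C := fun C hC =>
      rk_mono M (hJC C ((mem_factorFinset hG).1 hC))
    have h2 := (Finset.sum_eq_sum_iff_of_le h1).1
      ((Finset.sum_le_sum h1).antisymm ((hG.sum_rk X hX).le.trans hcov))
    exact fun C hC => h2 C ((mem_factorFinset hG).2 hC)
  have hJ : ∀ C ∈ factors G X, J C = C := fun C hC =>
    eq_of_rk_le (isFlat_join _) (hG.isFlat C (factor_mem hC)) (hJC C hC) (hrk C hC).ge
  have hfac : ∀ C ∈ factors G X, C ∈ maxes T := by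
    intro C hC
    -- Two or more maximal members inside `C` would form an antichain with join `C ∈ G`; having none
    -- would give `C` rank zero. So there is exactly one, and it equals `C`.
    have h1 : ((maxes T).filter (· ⊆ C)).card < 2 := by
      by_contra! h
      refine hT.2 _ ((Finset.filter_subset _ _).trans (maxes_subset T)) h ?_ ?_
      · exact (isAntichain_maxes T).subset (Finset.coe_subset.2 (Finset.filter_subset _ _))
      · have := hJ C hC
        simp only [J] at this
        rw [this]
        exact factor_mem hC
    have h2 : ((maxes T).filter (· ⊆ C)).Nonempty := by
      rw [Finset.nonempty_iff_ne_empty]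
      intro h
      have h3 := hrk C hC
      simp only [J, h, Finset.coe_empty, join, Set.sUnion_empty, rk_closure, rk_empty] at h3
      have h4 : C ⊆ M.closure ∅ := subset_closure_of_rk_le (Set.empty_subset _)
        (hG.isFlat C (factor_mem hC)).subset_ground (by rw [← h3, rk_empty])
      rw [closure_empty_eq] at h4
      exact (hG.nonempty C (factor_mem hC)).ne_empty (Set.subset_empty_iff.1 h4)
    obtain ⟨A, hA⟩ := Finset.card_eq_one.1 (show ((maxes T).filter (· ⊆ C)).card = 1 by
      have := h2.card_pos; omega)
    have h3 := hJ C hC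
    have hAm : A ∈ (maxes T).filter (· ⊆ C) := by simp [hA]
    have hAT := (Finset.mem_filter.1 hAm).1
    simp only [J, hA, Finset.coe_singleton, join, Set.sUnion_singleton] at h3
    rw [(hG.isFlat A (hmax A hAT)).closure] at h3
    exact h3 ▸ hAT
  ext A
  refine ⟨hfac A, fun hA => ?_⟩
  obtain ⟨C, hC, hAC⟩ := exists_factor_of_mem hG.isFlat (hmax A hA) (hmX A hA)
  rwa [(mem_maxes.1 hA).2 C (maxes_subset T (hfac C hC)) hAC]

theorem factorFinset_join (hT : IsNested M G T) :
    factorFinset M G (join M (T : Set (Set α))) = maxes T := by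
  ext A
  rw [mem_factorFinset hG, hG.factors_join hT, Finset.mem_coe]

theorem exists_subset_of_subset_join {g : Set α} (hT : IsNested M G T) (hg : g ∈ G)
    (h : g ⊆ join M (T : Set (Set α))) : ∃ F ∈ T, g ⊆ F := by
  obtain ⟨C, hC, hgC⟩ := exists_factor_of_mem hG.isFlat hg h
  rw [hG.factors_join hT] at hC
  exact ⟨C, maxes_subset T hC, hgC⟩

theorem join_eq_sUnion (hT : IsNested M G T) :
    join M (T : Set (Set α)) = ⋃₀ (T : Set (Set α)) := by
  refine Set.Subset.antisymm (fun e he => ?_) (Set.sUnion_subset fun A hA => hG.subset_join hT hA)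
  obtain ⟨A, hA, heA⟩ := hG.exists_mem _ (isFlat_join _) e he
  rw [hG.factors_join hT] at hA
  exact ⟨A, maxes_subset T hA, heA⟩

theorem sum_rk_maxes (hT : IsNested M G T) :
    ∑ A ∈ maxes T, rk M A = rk M (join M (T : Set (Set α))) := by
  rw [← hG.sum_rk _ (isFlat_join _), hG.factorFinset_join hT]

end IsFactorial
end Nested

/-! ### Predecessor joins, extensions of nested sets and local ranks. -/

/-- The set of members of `T` properly contained in `F`. -/
noncomputable def below (T : Finset (Set α)) (F : Set α) : Finset (Set α) := by
  classical exact T.filter (· ⊂ F)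

theorem mem_below : A ∈ below T F ↔ A ∈ T ∧ A ⊂ F := by simp [below]

theorem below_subset (T : Finset (Set α)) (F : Set α) : below T F ⊆ T :=
  fun _ h => (mem_below.1 h).1

theorem z_eq (T : Finset (Set α)) (F : Set α) : z M T F = join M (below T F) := by
  simp only [z, below, Finset.coe_filter]

theorem z_mono (h : S ⊆ T) : z M S F ⊆ z M T F :=
  join_mono fun _ hA => ⟨h hA.1, hA.2⟩

theorem isFlat_z (T : Finset (Set α)) (F : Set α) : M.IsFlat (z M T F) := isFlat_join _

theorem z_subset (hF : M.IsFlat F) : z M T F ⊆ F :=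
  join_subset hF fun _ hA => hA.2.subset

namespace IsFactorial

variable [M.Loopless] (hG : IsFactorial M G)
include hG

theorem subset_z (hT : IsNested M G T) (hA : A ∈ T) (hAF : A ⊂ F) : A ⊆ z M T F := by
  rw [z_eq]
  exact hG.subset_join (hT.subset (below_subset T F)) (mem_below.2 ⟨hA, hAF⟩)

theorem z_eq_sUnion (hT : IsNested M G T) : z M T F = ⋃₀ (below T F : Set (Set α)) := by
  rw [z_eq, hG.join_eq_sUnion (hT.subset (below_subset T F))]

theorem z_ssubset (hT : IsNested M G T) (hF : F ∈ G) : z M T F ⊂ F := by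
  refine (z_subset (hG.isFlat F hF)).ssubset_of_ne fun h => ?_
  rw [z_eq] at h
  obtain ⟨A, hA, hFA⟩ := hG.exists_subset_of_subset_join (hT.subset (below_subset T F)) hF h.ge
  exact (mem_below.1 hA).2.not_subset hFA

/-- Only antichains through the new member `A` need checking; the rest of such an antichain consists
of members of `U` incomparable to `A`. -/
theorem nested_insert_aux [DecidableEq (Set α)] (hU : IsNested M G U) (hA : A ∈ G)
    (h : ∀ D ⊆ U, D.Nonempty → (∀ B ∈ D, ¬ B ⊆ A ∧ ¬ A ⊆ B) →
      IsAntichain (· ⊆ ·) (D : Set (Set α)) → join M (insert A (D : Set (Set α))) ∉ G) :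
    IsNested M G (insert A U) := by
  refine ⟨by simpa [Set.insert_subset_iff, hA] using hU.1, fun C hC h2 hanti => ?_⟩
  by_cases hAC : A ∈ C
  · have hC' : insert A (C.erase A) = C := Finset.insert_erase hAC
    have := h (C.erase A) (by rwa [Finset.subset_insert_iff] at hC) ?_ ?_ ?_
    · rwa [← Finset.coe_insert, hC'] at this
    · rw [← Finset.card_pos, Finset.card_erase_of_mem hAC]; omega
    · intro B hB
      have hne := Finset.ne_of_mem_erase hB
      have hBC := Finset.mem_of_mem_erase hB
      exact ⟨hanti hBC hAC hne, hanti hAC hBC hne.symm⟩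
    · exact hanti.subset (Finset.coe_subset.2 (Finset.erase_subset _ _))
  · exact hU.2 C ((Finset.subset_insert_iff_of_notMem hAC).1 hC) h2 hanti

theorem nested_insert_of_subset [DecidableEq (Set α)] (hU : IsNested M G U) (hX : M.IsFlat X)
    (hUX : ∀ u ∈ U, u ⊆ X) (hA : A ∈ factors G X) : IsNested M G (insert A U) := by
  refine hG.nested_insert_aux hU (factor_mem hA) fun D hD hne hinc _ hJ => ?_
  have hfl : ∀ B ∈ insert A (D : Set (Set α)), M.IsFlat B := by
    rintro B (rfl | hB)
    exacts [hG.isFlat _ (factor_mem hA), hG.flat_of_nested hU (hD hB)]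
  have hAne := hG.nonempty A (factor_mem hA)
  have hAJ : A ⊆ join M (insert A (D : Set (Set α))) :=
    subset_join_of_mem hfl (Set.mem_insert _ _)
  have h1 : join M (insert A (D : Set (Set α))) ⊆ A := by
    refine hG.subset_factor hX hA hJ (join_subset hX ?_) ?_
    · rintro B (rfl | hB)
      exacts [factor_subset hA, hUX B (hD hB)]
    · rwa [Set.inter_eq_left.2 hAJ]
  obtain ⟨B, hB⟩ := hne
  exact (hinc B hB).1 ((subset_join_of_mem hfl (Set.mem_insert_of_mem _ hB)).trans h1)

/-- A member of `U` incomparable to `A` is either inside `Y` or disjoint from `F`. If all of `D` is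
inside `Y`, a join in `G` would lie in the factor `A`. Otherwise, replacing `A` and the members
inside `Y` by `F` moves the violation into `U` itself. -/
theorem nested_insert [DecidableEq (Set α)] (hU : IsNested M G U) (hF : F ∈ U) (hY : M.IsFlat Y)
    (hYF : Y ⊂ F) (hUY : ∀ u ∈ U, u ⊂ F → u ⊆ Y) (hA : A ∈ factors G Y) :
    IsNested M G (insert A U) := by
  refine hG.nested_insert_aux hU (factor_mem hA) fun D hD hne hinc hanti hJ => ?_
  have (B : Set α) : Decidable (B ∩ F).Nonempty := Classical.propDecidable _
  have hAF : A ⊂ F := (factor_subset hA).trans_ssubset hYF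
  have hfl : ∀ B ∈ insert A (D : Set (Set α)), M.IsFlat B := by
    rintro B (rfl | hB)
    exacts [hG.isFlat _ (factor_mem hA), hG.flat_of_nested hU (hD hB)]
  have hAne := hG.nonempty A (factor_mem hA)
  have hAJ : A ⊆ join M (insert A (D : Set (Set α))) :=
    subset_join_of_mem hfl (Set.mem_insert _ _)
  have hcase : ∀ B ∈ D, B ⊆ Y ∨ ¬ (B ∩ F).Nonempty := by
    intro B hB
    by_contra! hc
    rcases hG.subset_or_subset hU (hD hB) hF hc.2 with h | h
    · rcases h.eq_or_ssubset with rfl | h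
      · exact (hinc B hB).2 hAF.subset
      · exact hc.1 (hUY B (hD hB) h)
    · exact (hinc B hB).2 (hAF.subset.trans h)
  by_cases hall : ∀ B ∈ D, B ⊆ Y
  · have h1 : join M (insert A (D : Set (Set α))) ⊆ A := by
      refine hG.subset_factor hY hA hJ (join_subset hY ?_) ?_
      · rintro B (rfl | hB)
        exacts [factor_subset hA, hall B hB]
      · rwa [Set.inter_eq_left.2 hAJ]
    obtain ⟨B, hB⟩ := hne
    exact (hinc B hB).1 ((subset_join_of_mem hfl (Set.mem_insert_of_mem _ hB)).trans h1)
  · push Not at hall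
    set D' := D.filter fun B => ¬ (B ∩ F).Nonempty with hD'
    have hFD' : F ∉ D' := fun h => by
      have := (Finset.mem_filter.1 h).2
      rw [Set.inter_self] at this
      exact this (hG.nonempty F (hU.1 hF))
    refine hU.2 (insert F D') ?_ ?_ ?_ ?_
    · exact Finset.insert_subset hF ((Finset.filter_subset _ _).trans hD)
    · rw [Finset.card_insert_of_notMem hFD']
      obtain ⟨B, hB, hBY⟩ := hall
      have : 0 < D'.card := Finset.card_pos.2
        ⟨B, Finset.mem_filter.2 ⟨hB, (hcase B hB).resolve_left hBY⟩⟩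
      omega
    · rw [Finset.coe_insert]
      refine (hanti.subset (Finset.coe_subset.2 (Finset.filter_subset _ _))).insert ?_ ?_
      · intro B hB _ h
        refine (Finset.mem_filter.1 hB).2 ?_
        rw [Set.inter_eq_left.2 h]
        exact hG.nonempty B (hU.1 (hD (Finset.mem_filter.1 hB).1))
      · intro B hB _ h
        refine (Finset.mem_filter.1 hB).2 ?_
        rw [Set.inter_eq_right.2 h]
        exact hG.nonempty F (hU.1 hF)
    -- `F` and `J` both contain `A`, so their join is in `G`; it is also the join of `F` and the
    -- members of `D` disjoint from `F`.
    · set J := join M (insert A (D : Set (Set α))) with hJdef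
      have h1 : join M ({F, J} : Set (Set α)) ∈ G := by
        refine hG.join_mem (A := F) ?_ (by simp) ?_
        · simp [Set.insert_subset_iff, hU.1 hF, hJ]
        · simp only [Set.mem_insert_iff, Set.mem_singleton_iff, forall_eq_or_imp, forall_eq,
            Set.inter_self]
          exact ⟨hG.nonempty F (hU.1 hF), hAne.mono (Set.subset_inter hAF.subset hAJ)⟩
      have hfl2 : ∀ B ∈ ((insert F D' : Finset (Set α)) : Set (Set α)), M.IsFlat B := by
        intro B hB
        rcases Finset.mem_insert.1 (Finset.mem_coe.1 hB) with rfl | hB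
        · exact hG.flat_of_nested hU hF
        · exact hG.flat_of_nested hU (hD (Finset.mem_filter.1 hB).1)
      have hfl3 : ∀ B ∈ ({F, J} : Set (Set α)), M.IsFlat B := by
        rintro B (rfl | rfl)
        exacts [hG.flat_of_nested hU hF, isFlat_join _]
      have hF' : F ⊆ join M ((insert F D' : Finset (Set α)) : Set (Set α)) :=
        subset_join_of_mem hfl2 (by simp)
      convert h1 using 1
      apply Set.Subset.antisymm
      · refine join_subset (isFlat_join _) fun B hB => ?_
        rcases Finset.mem_insert.1 (Finset.mem_coe.1 hB) with rfl | hB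
        · exact subset_join_of_mem hfl3 (by simp)
        · exact (subset_join_of_mem hfl
            (Set.mem_insert_of_mem _ (Finset.mem_filter.1 hB).1)).trans
              (subset_join_of_mem (A := J) hfl3 (by simp))
      · refine join_subset (isFlat_join _) ?_
        rintro B (rfl | rfl)
        · exact hF'
        · refine join_subset (isFlat_join _) ?_
          rintro B (rfl | hB)
          · exact hAF.subset.trans hF'
          · rcases hcase B hB with h | h
            · exact h.trans (hYF.subset.trans hF')
            · exact subset_join_of_mem hfl2 (by simp [hD', h, Finset.mem_coe.1 hB])

/-- The local ranks of a nested set add up to the rank of its join. -/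
theorem sum_local_rk (hT : IsNested M G T) :
    ∑ F ∈ T, (rk M F - rk M (z M T F)) = rk M (join M (T : Set (Set α))) := by
  classical
  induction hn : T.card using Nat.strong_induction_on generalizing T with
  | _ n ih =>
  rcases T.eq_empty_or_nonempty with rfl | hne
  · simp [join, rk_closure, rk_empty]
  obtain ⟨F, hF⟩ : (maxes T).Nonempty := by
    obtain ⟨A, hA⟩ := hne
    obtain ⟨B, hB, -⟩ := exists_mem_maxes hA
    exact ⟨B, hB⟩
  obtain ⟨hFT, hFmax⟩ := mem_maxes.1 hF
  have hT' : IsNested M G (T.erase F) := hT.subset (Finset.erase_subset _ _)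
  have hz : ∀ F' ∈ T.erase F, z M T F' = z M (T.erase F) F' := by
    intro F' hF'
    obtain ⟨hne', hF'T⟩ := Finset.mem_erase.1 hF'
    rw [z_eq, z_eq]
    congr 2
    ext A
    simp only [mem_below, Finset.mem_erase]
    refine ⟨fun h => ⟨⟨?_, h.1⟩, h.2⟩, fun h => ⟨h.1.2, h.2⟩⟩
    rintro rfl
    exact hne' (hFmax F' hF'T h.2.subset).symm
  rw [← Finset.add_sum_erase _ _ hFT]
  rw [Finset.sum_congr rfl (fun F' hF' => by rw [hz F' hF']), ih _ (by
    rw [← hn]; exact Finset.card_erase_lt_of_mem hFT) hT' rfl]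
  rw [← hG.sum_rk_maxes hT, ← hG.sum_rk_maxes hT', z_eq,
    ← hG.sum_rk_maxes (hT.subset (below_subset T F))]
  -- Removing a maximal `F` exposes the maximal members below it, whose ranks add up to `rk z_T(F)`;
  -- the sum of local ranks and the rank of the join drop by the same amount.
  have hmax : maxes (T.erase F) = (maxes T).erase F ∪ maxes (below T F) := by
    ext A
    simp only [Finset.mem_union, Finset.mem_erase, mem_maxes, mem_below]
    constructor
    · rintro ⟨⟨hAF, hAT⟩, h⟩
      by_cases hsub : A ⊆ F
      · exact Or.inr ⟨⟨hAT, hsub.ssubset_of_ne hAF⟩, fun B hB => h B ⟨hB.2.ne, hB.1⟩⟩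
      · refine Or.inl ⟨hAF, hAT, fun B hB hAB => h B ⟨?_, hB⟩ hAB⟩
        rintro rfl
        exact hsub hAB
    · rintro (⟨hAF, hAT, h⟩ | ⟨⟨hAT, hAF⟩, h⟩)
      · exact ⟨⟨hAF, hAT⟩, fun B hB => h B hB.2⟩
      · refine ⟨⟨hAF.ne, hAT⟩, fun B hB hAB => h B ⟨hB.2, ?_⟩ hAB⟩
        have hAne := hG.nonempty A (hT.1 hAT)
        rcases hG.subset_or_subset hT hB.2 hFT
          (hAne.mono (Set.subset_inter hAB hAF.subset)) with h1 | h1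
        · exact h1.ssubset_of_ne hB.1
        · exact (hB.1 (hFmax B hB.2 h1).symm).elim
  have hdisj : Disjoint ((maxes T).erase F) (maxes (below T F)) := by
    rw [Finset.disjoint_left]
    intro A hA hA'
    have h1 := mem_below.1 (maxes_subset _ hA')
    exact h1.2.ne ((mem_maxes.1 (Finset.mem_of_mem_erase hA)).2 F hFT h1.2.subset)
  rw [hmax, Finset.sum_union hdisj, ← Finset.add_sum_erase _ _ hF]
  have hle : ∑ A ∈ maxes (below T F), rk M A ≤ rk M F := by
    rw [hG.sum_rk_maxes (hT.subset (below_subset T F)), ← z_eq]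
    exact rk_mono M (z_subset (hG.flat_of_nested hT hFT))
  omega

theorem nested_union_factors [DecidableEq (Set α)] (hX : M.IsFlat X) (hT : IsNested M G T)
    (hTX : ∀ u ∈ T, u ⊆ X) : IsNested M G (T ∪ factorFinset M G X) := by
  suffices h : ∀ V ⊆ factorFinset M G X, IsNested M G (T ∪ V) from h _ subset_rfl
  intro V
  induction V using Finset.induction_on with
  | empty => intro _; simpa using hT
  | insert A V hAV ih =>
    intro h
    rw [Finset.union_insert]
    have hA := (mem_factorFinset hG).1 (h (Finset.mem_insert_self _ _))
    refine hG.nested_insert_of_subset (ih ((Finset.subset_insert _ _).trans h)) hX ?_ hA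
    intro u hu
    rcases Finset.mem_union.1 hu with hu | hu
    · exact hTX u hu
    · exact factor_subset ((mem_factorFinset hG).1 (h (Finset.mem_insert_of_mem hu)))

theorem exists_subset_factor_ground {g : Set α} (hg : g ∈ G) :
    ∃ F ∈ factorFinset M G M.E, g ⊆ F := by
  obtain ⟨C, hC, h⟩ := exists_factor_of_mem (X := M.E) hG.isFlat hg (hG.isFlat g hg).subset_ground
  exact ⟨C, (mem_factorFinset hG).2 hC, h⟩

theorem join_eq_ground (hT : IsNested M G T) (h : factorFinset M G M.E ⊆ T) :
    join M (T : Set (Set α)) = M.E := by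
  refine (isFlat_join _).subset_ground.antisymm fun e he => ?_
  obtain ⟨A, hA, heA⟩ := hG.exists_mem M.E M.ground_isFlat e he
  exact hG.subset_join hT (h ((mem_factorFinset hG).2 hA)) heA

end IsFactorial

/-! ### Bases of maximal weight. -/

section Weight

theorem weight_coneVector (T : Finset (Set α)) {B : Set α} (hB : B.Finite) :
    weight (coneVector T) B = ∑ F ∈ T, ((B ∩ F).ncard : ℝ) := by
  classical
  rw [weight, finsum_mem_eq_finite_toFinset_sum _ hB]
  simp only [coneVector, Finset.sum_apply]
  rw [Finset.sum_comm]
  refine Finset.sum_congr rfl fun F _ => ?_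
  simp only [Set.indicator_apply, Finset.sum_boole]
  congr 1
  rw [← Set.ncard_coe_finset]
  congr 1
  ext e
  simp

theorem ncard_inter_le_rk {B : Set α} (hB : M.IsBase B) (F : Set α) : (B ∩ F).ncard ≤ rk M F :=
  ncard_le_rk (hB.indep.subset Set.inter_subset_left) Set.inter_subset_right

/-- The weight of a base is the sum of `#(B ∩ F)` over `F ∈ T`, and each term is at most `rk F`.
Since `B₀` attains all these bounds at once, so does every maximizer. -/
theorem isBase_initialAt_iff {B₀ : Set α} (h₀ : M.IsBase B₀)
    (hr : ∀ F ∈ T, (B₀ ∩ F).ncard = rk M F) {B : Set α} :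
    (initialAt M T).IsBase B ↔ M.IsBase B ∧ ∀ F ∈ T, (B ∩ F).ncard = rk M F := by
  have hfin : ∀ {B}, M.IsBase B → B.Finite := fun h => finite_of_subset h.subset_ground
  have hub : ∀ {B}, M.IsBase B → ∀ F ∈ T, ((B ∩ F).ncard : ℝ) ≤ rk M F := fun h F _ => by
    exact_mod_cast ncard_inter_le_rk h F
  have hmax : ∀ {B}, M.IsBase B → weight (coneVector T) B ≤ ∑ F ∈ T, (rk M F : ℝ) := fun h => by
    rw [weight_coneVector T (hfin h)]
    exact Finset.sum_le_sum (hub h)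
  have hmax₀ : weight (coneVector T) B₀ = ∑ F ∈ T, (rk M F : ℝ) := by
    rw [weight_coneVector T (hfin h₀)]
    exact Finset.sum_congr rfl fun F hF => by rw [hr F hF]
  change IsMaxWeightBase M (coneVector T) B ↔ _
  refine and_congr_right fun hB => ⟨fun h => ?_, fun h B' hB' => ?_⟩
  · have h1 := h B₀ h₀
    rw [hmax₀, weight_coneVector T (hfin hB)] at h1
    have h2 := (Finset.sum_eq_sum_iff_of_le (hub hB)).1 ((Finset.sum_le_sum (hub hB)).antisymm h1)
    exact fun F hF => by exact_mod_cast h2 F hF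
  · have : weight (coneVector T) B = ∑ F ∈ T, (rk M F : ℝ) := by
      rw [weight_coneVector T (hfin hB)]
      exact Finset.sum_congr rfl fun F hF => by rw [h F hF]
    exact this ▸ hmax hB'

end Weight

/-! ### The direct sum decomposition of the initial matroid. -/

section Cells

/-- The part of `F` outside the join of the smaller members of `T`. -/
noncomputable def cell (M : Matroid α) [M.Finite] (T : Finset (Set α)) (F : Set α) : Finset α := by
  classical exact M.ground_finite.toFinset.filter (· ∈ F \ z M T F)

theorem coe_cell (hF : F ⊆ M.E) : (cell M T F : Set α) = F \ z M T F := by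
  ext e
  simp only [cell, Finset.coe_filter, Set.Finite.mem_toFinset, Set.mem_ofPred_eq,
    and_iff_right_iff_imp]
  exact fun h => hF h.1

/-- A basis of `F` outside `Y` relative to `Y`, chosen to meet `A` as much as possible. -/
theorem exists_relative_basis (hYF : Y ⊆ F) (hF : F ⊆ M.E) (A : Set α) (hA : A ⊆ F \ Y) :
    ∃ J ⊆ F \ Y, F ⊆ M.closure (Y ∪ J) ∧ J.ncard = rk M F - rk M Y ∧
      rk M (A ∪ Y) - rk M Y ≤ (J ∩ A).ncard := by
  -- Bases `K ⊆ I ⊆ L` of `Y ⊆ A ∪ Y ⊆ F` are chosen successively; the witness is `L \ Y`.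
  obtain ⟨K, hK⟩ := M.exists_isBasis Y (hYF.trans hF)
  have hAY : A ∪ Y ⊆ F := Set.union_subset (hA.trans Set.sdiff_subset) hYF
  obtain ⟨I, hI, hKI⟩ := hK.indep.subset_isBasis_of_subset
    (hK.subset.trans Set.subset_union_right) (hAY.trans hF)
  obtain ⟨L, hL, hIL⟩ := hI.indep.subset_isBasis_of_subset (hI.subset.trans hAY) hF
  have hLfin : L.Finite := finite_of_subset hL.indep.subset_ground
  have hLY : L ∩ Y = K := by
    refine ((hK.eq_of_subset_indep (hL.indep.subset Set.inter_subset_left) ?_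
      Set.inter_subset_right)).symm
    exact Set.subset_inter (hKI.trans hIL) hK.subset
  have hcL : (L \ Y).ncard + rk M Y = rk M F := by
    rw [← ncard_basis hL, ← ncard_basis hK, ← hLY, add_comm,
      Set.ncard_inter_add_ncard_sdiff_eq_ncard L Y hLfin]
  refine ⟨L \ Y, Set.sdiff_subset_sdiff_left hL.subset, ?_, by omega, ?_⟩
  · have h1 : L ⊆ Y ∪ L \ Y := by rw [Set.union_sdiff_self]; exact Set.subset_union_right
    exact hL.subset_closure.trans (M.closure_subset_closure h1)
  · have hIY : I ∩ Y = K := by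
      refine Set.Subset.antisymm ?_ (Set.subset_inter hKI hK.subset)
      rw [← hLY]
      exact Set.inter_subset_inter_left _ hIL
    have h1 : (I \ Y).ncard + rk M Y = rk M (A ∪ Y) := by
      rw [← ncard_basis hI, ← ncard_basis hK, ← hIY, add_comm,
        Set.ncard_inter_add_ncard_sdiff_eq_ncard I Y (hLfin.subset hIL)]
    have h2 : (I \ Y).ncard ≤ (L \ Y ∩ A).ncard := by
      refine Set.ncard_le_ncard ?_ (hLfin.sdiff.inter_of_left _)
      intro e he
      exact ⟨⟨hIL he.1, he.2⟩, (hI.subset he.1).resolve_right he.2⟩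
    omega

namespace IsFactorial

variable [M.Loopless] (hG : IsFactorial M G)
include hG

theorem coe_cell_of_mem (hT : IsNested M G T) (hF : F ∈ T) : (cell M T F : Set α) = F \ z M T F :=
  coe_cell (hG.flat_of_nested hT hF).subset_ground

theorem disjoint_cell (hT : IsNested M G T) {F' : Set α} (hF : F ∈ T) (hF' : F' ∈ T)
    (h : F ≠ F') : Disjoint (cell M T F) (cell M T F') := by
  rw [← Finset.disjoint_coe, hG.coe_cell_of_mem hT hF, hG.coe_cell_of_mem hT hF',
    Set.disjoint_left]
  intro e he he'
  rcases hG.subset_or_subset hT hF hF' ⟨e, he.1, he'.1⟩ with h1 | h1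
  · exact he'.2 (hG.subset_z hT hF (h1.ssubset_of_ne h) he.1)
  · exact he.2 (hG.subset_z hT hF' (h1.ssubset_of_ne h.symm) he'.1)

theorem biUnion_cell [DecidableEq α] (hT : IsNested M G T) (h : factorFinset M G M.E ⊆ T) :
    T.biUnion (cell M T) = M.ground_finite.toFinset := by
  ext e
  simp only [Finset.mem_biUnion, Set.Finite.mem_toFinset]
  constructor
  · rintro ⟨F, hF, he⟩
    simp only [cell, Finset.mem_filter, Set.Finite.mem_toFinset] at he
    exact he.1
  · intro he
    rw [← hG.join_eq_ground hT h, hG.join_eq_sUnion hT] at he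
    obtain ⟨F, hF, heF⟩ := he
    -- The cell containing `e` is that of a minimal member of `T` containing `e`.
    classical
    obtain ⟨F', -, hF'⟩ := (T.filter (e ∈ ·)).exists_le_minimal
      (Finset.mem_filter.2 ⟨hF, heF⟩)
    obtain ⟨hF'T, heF'⟩ := Finset.mem_filter.1 hF'.1
    refine ⟨F', hF'T, ?_⟩
    rw [← Finset.mem_coe, hG.coe_cell_of_mem hT hF'T]
    refine ⟨heF', fun hz => ?_⟩
    rw [hG.z_eq_sUnion hT] at hz
    obtain ⟨A, hA, heA⟩ := hz
    obtain ⟨hAT, hAF⟩ := mem_below.1 hA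
    exact hAF.not_subset (hF'.2 (Finset.mem_filter.2 ⟨hAT, heA⟩) hAF.subset)

theorem sum_ncard_inter_cell (hT : IsNested M G T) (h : factorFinset M G M.E ⊆ T)
    (hX : X ⊆ M.E) : ∑ F ∈ T, (X ∩ cell M T F).ncard = X.ncard := by
  classical
  have hfin := finite_of_subset hX
  have h1 : hfin.toFinset = T.biUnion fun F => hfin.toFinset ∩ cell M T F := by
    rw [← Finset.inter_biUnion, hG.biUnion_cell hT h]
    ext e
    simpa using fun he => hX he
  rw [Set.ncard_eq_toFinset_card X hfin, h1, Finset.card_biUnion]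
  · refine Finset.sum_congr rfl fun F _ => ?_
    rw [← Set.ncard_coe_finset]
    simp
  · intro F hF F' hF' hne
    exact (hG.disjoint_cell hT hF hF' hne).mono Finset.inter_subset_right Finset.inter_subset_right

/-- A basis adapted to a nested set, chosen to meet `A` as much as possible. -/
theorem exists_adapted_base (hT : IsNested M G T) (h : factorFinset M G M.E ⊆ T) (A : Set α) :
    ∃ B, M.IsBase B ∧ (∀ F ∈ T, (B ∩ F).ncard = rk M F) ∧
      ∑ F ∈ T, (rk M (A ∩ cell M T F ∪ z M T F) - rk M (z M T F)) ≤ (B ∩ A).ncard := by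
  classical
  have hflat : ∀ F ∈ T, M.IsFlat F := fun F hF => hG.flat_of_nested hT hF
  have hJ : ∀ F : Set α, ∃ J : Set α, F ∈ T → J ⊆ cell M T F ∧ F ⊆ M.closure (z M T F ∪ J) ∧
      J.ncard = rk M F - rk M (z M T F) ∧
      rk M (A ∩ cell M T F ∪ z M T F) - rk M (z M T F) ≤ (J ∩ A).ncard := by
    intro F
    by_cases hF : F ∈ T
    · have hc := hG.coe_cell_of_mem hT hF
      obtain ⟨J, h1, h2, h3, h4⟩ := exists_relative_basis (z_subset (T := T) (hflat F hF))
        (hflat F hF).subset_ground (A ∩ cell M T F) (by rw [hc]; exact Set.inter_subset_right)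
      refine ⟨J, fun _ => ⟨hc ▸ h1, h2, h3, h4.trans ?_⟩⟩
      refine Set.ncard_le_ncard (Set.inter_subset_inter_right _ Set.inter_subset_left) ?_
      exact (finite_of_subset (h1.trans (Set.sdiff_subset.trans
        (hflat F hF).subset_ground))).inter_of_left _
    · exact ⟨∅, fun h => (hF h).elim⟩
  choose J hJ using hJ
  -- Relative bases are glued over the cells. The union spans every `F ∈ T`, by induction on the
  -- size of `F`.
  set B : Set α := ⋃ F ∈ T, J F with hB
  have hcellE : ∀ F, (cell M T F : Set α) ⊆ M.E := fun F e he => by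
    simp only [cell, Finset.coe_filter, Set.Finite.mem_toFinset] at he
    exact he.1
  have hBE : B ⊆ M.E := Set.iUnion₂_subset fun F hF => (hJ F hF).1.trans (hcellE F)
  have hBcell : ∀ F ∈ T, B ∩ cell M T F = J F := by
    intro F hF
    refine Set.Subset.antisymm ?_ (Set.subset_inter (Set.subset_biUnion_of_mem hF) (hJ F hF).1)
    rintro e ⟨heB, he⟩
    obtain ⟨F', hF', heJ⟩ := Set.mem_iUnion₂.1 heB
    by_cases hne : F = F'
    · exact hne ▸ heJ
    · exact (Finset.disjoint_left.1 (hG.disjoint_cell hT hF hF' hne) he ((hJ F' hF').1 heJ)).elim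
  have hspan : ∀ F ∈ T, F ⊆ M.closure (B ∩ F) := by
    intro F hF
    induction hn : F.ncard using Nat.strong_induction_on generalizing F with
    | _ n ih =>
    have hfin := finite_of_subset (hflat F hF).subset_ground
    have h1 : z M T F ⊆ M.closure (B ∩ F) := by
      refine closure_subset_flat (M.isFlat_closure _) (Set.sUnion_subset ?_)
      rintro F' ⟨hF', hlt⟩
      exact (ih _ (hn ▸ Set.ncard_lt_ncard hlt hfin) F' hF' rfl).trans
        (M.closure_subset_closure (Set.inter_subset_inter_right _ hlt.subset))
    refine (hJ F hF).2.1.trans (closure_subset_flat (M.isFlat_closure _) (Set.union_subset h1 ?_))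
    have h2 : J F ⊆ B ∩ F := by
      rw [← hBcell F hF, hG.coe_cell_of_mem hT hF]
      exact Set.inter_subset_inter_right _ Set.sdiff_subset
    exact h2.trans (M.subset_closure _ (Set.inter_subset_left.trans hBE))
  have hEB : M.E ⊆ M.closure B := by
    have h1 : join M (T : Set (Set α)) ⊆ M.closure B := join_subset (M.isFlat_closure _)
      fun F hF => (hspan F hF).trans (M.closure_subset_closure Set.inter_subset_left)
    rwa [hG.join_eq_ground hT h] at h1
  -- By `sum_local_rk` the spanning set `B` has exactly `rk E` elements, hence is independent.
  have hcard : B.ncard = rk M M.E := by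
    rw [← hG.sum_ncard_inter_cell hT h hBE, ← hG.join_eq_ground hT h, ← hG.sum_local_rk hT]
    exact Finset.sum_congr rfl fun F hF => by rw [hBcell F hF, (hJ F hF).2.2.1]
  have hbase : M.IsBase B := by
    have hBfin := finite_of_subset hBE
    refine Matroid.Indep.isBase_of_ground_subset_closure ?_ hEB
    refine (M.isRkFinite_set B).indep_of_encard_le_eRk ?_
    rw [← hBfin.cast_ncard_eq, ← cast_rk, hcard]
    have := rk_mono M hEB
    rw [rk_closure] at this
    exact_mod_cast this
  refine ⟨B, hbase, fun F hF => (ncard_inter_le_rk hbase F).antisymm ?_, ?_⟩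
  · have h1 := rk_mono M (hspan F hF)
    rwa [rk_closure, rk_of_indep (hbase.indep.subset Set.inter_subset_left)] at h1
  · rw [← hG.sum_ncard_inter_cell hT h (Set.inter_subset_left.trans hBE)]
    refine Finset.sum_le_sum fun F hF => (hJ F hF).2.2.2.trans (le_of_eq ?_)
    rw [Set.inter_right_comm, hBcell F hF]

theorem nested_union_top [DecidableEq (Set α)] (hT : IsNested M G T) :
    IsNested M G (T ∪ factorFinset M G M.E) :=
  hG.nested_union_factors M.ground_isFlat hT fun _ hu => (hG.flat_of_nested hT hu).subset_ground

theorem isBase_initialAt (hT : IsNested M G T) {B : Set α} :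
    (initialAt M T).IsBase B ↔ M.IsBase B ∧ ∀ F ∈ T, (B ∩ F).ncard = rk M F := by
  classical
  obtain ⟨B₀, h1, h2, -⟩ := hG.exists_adapted_base (hG.nested_union_top hT)
    Finset.subset_union_right ∅
  exact isBase_initialAt_iff h1 fun F hF => h2 F (Finset.mem_union_left _ hF)

theorem sum_ncard_inter_factors (hX : M.IsFlat X) {B : Set α} (hB : B ⊆ M.E) :
    ∑ A ∈ factorFinset M G X, (B ∩ A).ncard = (B ∩ X).ncard := by
  classical
  have hfin : ∀ A : Set α, (B ∩ A).Finite := fun A =>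
    finite_of_subset (Set.inter_subset_left.trans hB)
  have h2 : (hfin X).toFinset = (factorFinset M G X).biUnion fun A => (hfin A).toFinset := by
    ext e
    simp only [Set.Finite.mem_toFinset, Finset.mem_biUnion, mem_factorFinset hG]
    constructor
    · rintro ⟨heB, heX⟩
      obtain ⟨A, hA, heA⟩ := hG.exists_mem X hX e heX
      exact ⟨A, hA, heB, heA⟩
    · rintro ⟨A, hA, heB, heA⟩
      exact ⟨heB, factor_subset hA heA⟩
  rw [Set.ncard_eq_toFinset_card _ (hfin X), h2, Finset.card_biUnion]
  · exact Finset.sum_congr rfl fun A _ => Set.ncard_eq_toFinset_card _ _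
  · intro A hA A' hA' hne
    rw [Function.onFun, Finset.disjoint_left]
    simp only [Set.Finite.mem_toFinset]
    rintro e ⟨-, he⟩ ⟨-, he'⟩
    exact hne (hG.eq_of_mem X hX A ((mem_factorFinset hG).1 hA) A'
      ((mem_factorFinset hG).1 hA') e he he')

/-- A base meets every factor of `X` in a basis as soon as it does so for `X`. -/
theorem ncard_inter_eq_iff (hX : M.IsFlat X) {B : Set α} (hB : M.IsBase B) :
    (B ∩ X).ncard = rk M X ↔ ∀ A ∈ factorFinset M G X, (B ∩ A).ncard = rk M A := by
  rw [← hG.sum_ncard_inter_factors hX hB.subset_ground, ← hG.sum_rk X hX]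
  exact Finset.sum_eq_sum_iff_of_le fun A _ => ncard_inter_le_rk hB A

/-- Every base of `M` already meets each factor of `E` in a basis, so these factors impose no
condition. -/
theorem initialAt_union_top [DecidableEq (Set α)] (hT : IsNested M G T) :
    initialAt M (T ∪ factorFinset M G M.E) = initialAt M T := by
  refine Matroid.ext_isBase rfl fun B _ => ?_
  rw [hG.isBase_initialAt hT, hG.isBase_initialAt (hG.nested_union_top hT)]
  refine and_congr_right fun hB => ⟨fun h F hF => h F (Finset.mem_union_left _ hF),
    fun h F hF => ?_⟩
  rcases Finset.mem_union.1 hF with hF | hF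
  · exact h F hF
  · refine (hG.ncard_inter_eq_iff M.ground_isFlat hB).1 ?_ F hF
    rw [Set.inter_eq_left.2 hB.subset_ground, ncard_base hB]

/-- This is the rank function of the direct sum of the minors `(M | F) / z_T(F)`. The lower bound is
the adapted base that meets `A` as much as possible. -/
theorem rk_initialAt (hT : IsNested M G T) (h : factorFinset M G M.E ⊆ T) (hA : A ⊆ M.E) :
    rk (initialAt M T) A =
      ∑ F ∈ T, (rk M (A ∩ cell M T F ∪ z M T F) - rk M (z M T F)) := by
  apply le_antisymm
  · obtain ⟨I, hI⟩ := (initialAt M T).exists_isBasis A hA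
    obtain ⟨B, hB, hIB⟩ := hI.indep.exists_isBase_superset
    obtain ⟨hB, hBr⟩ := (hG.isBase_initialAt hT).1 hB
    rw [← ncard_basis hI, ← hG.sum_ncard_inter_cell hT h (hI.subset.trans hA)]
    refine Finset.sum_le_sum fun F hF => ?_
    have hFE := (hG.flat_of_nested hT hF).subset_ground
    have hBfin : B.Finite := finite_of_subset hB.subset_ground
    -- `B` spans every member of `T` below `F`, hence their join, so `B ∩ z` can be adjoined to `I ∩
    -- cell` at full rank.
    have h1 : rk M (z M T F) ≤ (B ∩ z M T F).ncard := by
      rw [← rk_of_indep (hB.indep.subset Set.inter_subset_left), ← rk_closure (B ∩ _)]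
      refine rk_mono M (closure_subset_flat (M.isFlat_closure _) (Set.sUnion_subset ?_))
      rintro F' ⟨hF', hlt⟩
      have h2 : F' ⊆ M.closure (B ∩ F') := subset_closure_of_rk_le Set.inter_subset_right
        (hG.flat_of_nested hT hF').subset_ground
        (by rw [rk_of_indep (hB.indep.subset Set.inter_subset_left), hBr F' hF'])
      exact h2.trans (M.closure_subset_closure
        (Set.inter_subset_inter_right _ (hG.subset_z hT hF' hlt)))
    have h2 : (I ∩ cell M T F).ncard + (B ∩ z M T F).ncard ≤
        rk M (A ∩ cell M T F ∪ z M T F) := by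
      rw [← Set.ncard_union_eq ?_ ((hBfin.subset hIB).inter_of_left _) (hBfin.inter_of_left _)]
      · refine ncard_le_rk (hB.indep.subset ?_) ?_
        · exact Set.union_subset (Set.inter_subset_left.trans hIB) Set.inter_subset_left
        · exact Set.union_subset_union (Set.inter_subset_inter_left _ hI.subset)
            Set.inter_subset_right
      · rw [hG.coe_cell_of_mem hT hF]
        exact Set.disjoint_left.2 fun e he he' => he.2.2 he'.2
    omega
  · obtain ⟨B, hB, hBr, hle⟩ := hG.exists_adapted_base hT h A
    refine hle.trans (ncard_le_rk ?_ Set.inter_subset_right)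
    exact ((hG.isBase_initialAt hT).2 ⟨hB, hBr⟩).indep.subset Set.inter_subset_left

end IsFactorial
end Cells

/-! ### Multiplicativity of the characteristic polynomial. -/

section CharPoly

theorem sum_powerset_union {β R : Type*} [DecidableEq β] [AddCommMonoid R] {s t : Finset β}
    (h : Disjoint s t) (f : Finset β → R) :
    ∑ A ∈ (s ∪ t).powerset, f A = ∑ A ∈ s.powerset, ∑ B ∈ t.powerset, f (A ∪ B) := by
  rw [← Finset.sum_product']
  symm
  refine Finset.sum_nbij' (fun p => p.1 ∪ p.2) (fun A => (A ∩ s, A ∩ t)) ?_ ?_ ?_ ?_ ?_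
  · rintro ⟨A, B⟩ hp
    simp only [Finset.mem_product, Finset.mem_powerset] at hp ⊢
    exact Finset.union_subset_union hp.1 hp.2
  · intro A _
    simp [Finset.mem_product, Finset.mem_powerset]
  · rintro ⟨A, B⟩ hp
    simp only [Finset.mem_product, Finset.mem_powerset] at hp
    rw [Finset.disjoint_left] at h
    ext e
    · simp only [Finset.mem_inter, Finset.mem_union]
      exact ⟨fun he => he.1.resolve_right fun hB => h he.2 (hp.2 hB), fun he => ⟨.inl he, hp.1 he⟩⟩
    · simp only [Finset.mem_inter, Finset.mem_union]
      exact ⟨fun he => he.1.resolve_left fun hA => h (hp.1 hA) he.2, fun he => ⟨.inr he, hp.2 he⟩⟩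
  · intro A hA
    rw [← Finset.inter_union_distrib_left, Finset.inter_eq_left]
    exact Finset.mem_powerset.1 hA
  · intro _ _; rfl

theorem sum_powerset_biUnion_prod {ι β R : Type*} [DecidableEq β] [CommSemiring R]
    (T : Finset ι) (D : ι → Finset β)
    (hD : (T : Set ι).PairwiseDisjoint D) (f : ι → Finset β → R) :
    ∑ A ∈ (T.biUnion D).powerset, ∏ i ∈ T, f i (A ∩ D i) =
      ∏ i ∈ T, ∑ A ∈ (D i).powerset, f i A := by
  classical
  induction T using Finset.induction_on with
  | empty => simp
  | insert i T hi ih =>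
    rw [Finset.coe_insert, Set.pairwiseDisjoint_insert_of_notMem (by simpa using hi)] at hD
    have hdisj : Disjoint (D i) (T.biUnion D) := by
      rw [Finset.disjoint_biUnion_right]
      exact fun j hj => hD.2 j hj
    rw [Finset.biUnion_insert, sum_powerset_union hdisj, Finset.prod_insert hi, ← ih hD.1,
      Finset.sum_mul_sum]
    refine Finset.sum_congr rfl fun A hA => Finset.sum_congr rfl fun B hB => ?_
    rw [Finset.mem_powerset] at hA hB
    rw [Finset.prod_insert hi]
    have h1 : (A ∪ B) ∩ D i = A := by
      rw [Finset.union_inter_distrib_right, Finset.inter_eq_left.2 hA,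
        Finset.disjoint_iff_inter_eq_empty.1 (hdisj.symm.mono_left hB), Finset.union_empty]
    rw [h1]
    congr 1
    refine Finset.prod_congr rfl fun j hj => ?_
    rw [Finset.union_inter_distrib_right,
      Finset.disjoint_iff_inter_eq_empty.1 ((hD.2 j hj).mono_left hA), Finset.empty_union]

open Classical in
/-- The characteristic polynomial of the minor `(M | F) / Y`. -/
noncomputable def chi (M : Matroid α) [M.Finite] (Y F : Set α) : ℤ[X] :=
  ∑ A ∈ (M.ground_finite.toFinset.filter (· ∈ F \ Y)).powerset,
    (-1) ^ A.card * Polynomial.X ^ (rk M F - rk M (A ∪ Y))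

theorem chi_z (T : Finset (Set α)) (F : Set α) :
    chi M (z M T F) F = ∑ A ∈ (cell M T F).powerset,
      (-1) ^ A.card * Polynomial.X ^ (rk M F - rk M (A ∪ z M T F)) := by
  simp only [chi, cell]

/-- The cells partition `E` and both cardinality and corank of a subset are sums over cells, so the
subset expansion factors. -/
theorem IsFactorial.charPoly_initialAt [M.Loopless] (hG : IsFactorial M G) (hT : IsNested M G T)
    (h : factorFinset M G M.E ⊆ T) :
    charPoly (initialAt M T) = ∏ F ∈ T, chi M (z M T F) F := by
  classical
  have hD : (T : Set (Set α)).PairwiseDisjoint (cell M T) := fun F hF F' hF' hne =>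
    hG.disjoint_cell hT hF hF' hne
  simp only [chi_z]
  rw [← sum_powerset_biUnion_prod T (cell M T) hD
    (fun F A => (-1) ^ A.card * (Polynomial.X : ℤ[X]) ^ (rk M F - rk M (A ∪ z M T F))),
    hG.biUnion_cell hT h]
  refine Finset.sum_congr rfl fun A hA => ?_
  have hAE : (A : Set α) ⊆ M.E := by
    have := Finset.coe_subset.2 (Finset.mem_powerset.1 hA)
    rwa [Set.Finite.coe_toFinset] at this
  rw [Finset.prod_mul_distrib, Finset.prod_pow_eq_pow_sum, Finset.prod_pow_eq_pow_sum]
  have hcF : ∀ F ∈ T, (cell M T F : Set α) ⊆ F := fun F hF => by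
    rw [hG.coe_cell_of_mem hT hF]; exact Set.sdiff_subset
  congr 2
  · rw [← Set.ncard_coe_finset, ← hG.sum_ncard_inter_cell hT h hAE]
    refine Finset.sum_congr rfl fun F _ => ?_
    rw [← Set.ncard_coe_finset, Finset.coe_inter]
  · change rk (initialAt M T) M.E - _ = _
    rw [hG.rk_initialAt hT h hAE, hG.rk_initialAt hT h subset_rfl, ← Finset.sum_tsub_distrib]
    · refine Finset.sum_congr rfl fun F hF => ?_
      have h1 : M.E ∩ cell M T F ∪ z M T F = F := by
        rw [Set.inter_eq_right.2 ((hcF F hF).trans (hG.flat_of_nested hT hF).subset_ground),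
          hG.coe_cell_of_mem hT hF, Set.sdiff_union_of_subset
          (z_subset (hG.flat_of_nested hT hF))]
      have h2 : rk M (z M T F) ≤ rk M (A ∩ cell M T F ∪ z M T F) :=
        rk_mono M Set.subset_union_right
      rw [h1, Finset.coe_inter]
      omega
    · intro F hF
      refine Nat.sub_le_sub_right (rk_mono M ?_) _
      exact Set.union_subset_union_left _ (Set.inter_subset_inter_left _ hAE)

end CharPoly

/-! ### Möbius inversion in the lattice of flats. -/

section Mobius

open Classical in
/-- The Möbius function of the lattice of flats, as a signed count of spanning subsets. -/
noncomputable def mobius (M : Matroid α) [M.Finite] (Y X : Set α) : ℤ :=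
  ∑ A ∈ (M.ground_finite.toFinset.filter (· ∉ Y)).powerset.filter
    (fun A : Finset α => M.closure ((A : Set α) ∪ Y) = X), (-1) ^ A.card

-- Grouping subsets by closure, the left side is a signed count of all subsets of `X \ Y`, which
-- vanishes unless this set is empty.
open Classical in
theorem sum_mobius (hY : M.IsFlat Y) (hX : M.IsFlat X) :
    (∑ Z ∈ flats M, mobius M Y Z * (if Z ⊆ X then 1 else 0)) = if Y = X then 1 else 0 := by
  classical
  have h0 : ∑ Z ∈ flats M, mobius M Y Z * (if Z ⊆ X then 1 else 0) =
      ∑ A ∈ (M.ground_finite.toFinset.filter (· ∉ Y)).powerset,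
        if M.closure (A ∪ Y) ⊆ X then (-1) ^ A.card else 0 := by
    rw [← Finset.sum_fiberwise_of_maps_to
      (g := fun A : Finset α => M.closure ((A : Set α) ∪ Y)) (t := flats M)
      (fun A _ => mem_flats.2 (M.isFlat_closure _))]
    refine Finset.sum_congr rfl fun Z _ => ?_
    simp only [mobius, Finset.sum_mul]
    refine Finset.sum_congr rfl fun A hA => ?_
    rw [(Finset.mem_filter.1 hA).2, mul_ite, mul_one, mul_zero]
  rw [h0]
  have hcl : ∀ A : Finset α, A ⊆ M.ground_finite.toFinset →
      (M.closure (A ∪ Y) ⊆ X ↔ (A : Set α) ⊆ X ∧ Y ⊆ X) := by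
    intro A hA
    rw [← Set.union_subset_iff]
    refine ⟨fun h => (M.subset_closure _ ?_).trans h, fun h => closure_subset_flat hX h⟩
    refine Set.union_subset ?_ hY.subset_ground
    have := Finset.coe_subset.2 hA
    rwa [Set.Finite.coe_toFinset] at this
  by_cases hYX : Y ⊆ X
  · have h1 : ∑ A ∈ (M.ground_finite.toFinset.filter (· ∉ Y)).powerset,
        (if M.closure (A ∪ Y) ⊆ X then (-1 : ℤ) ^ A.card else 0) =
        ∑ A ∈ (M.ground_finite.toFinset.filter (· ∈ X \ Y)).powerset, (-1 : ℤ) ^ A.card := by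
      rw [← Finset.sum_filter]
      refine Finset.sum_congr ?_ fun _ _ => rfl
      ext A
      simp only [Finset.mem_filter, Finset.mem_powerset]
      constructor
      · rintro ⟨h1, h2⟩
        have h3 := ((hcl A (h1.trans (Finset.filter_subset _ _))).1 h2).1
        intro e he
        have := Finset.mem_filter.1 (h1 he)
        exact Finset.mem_filter.2 ⟨this.1, h3 he, this.2⟩
      · intro h
        refine ⟨fun e he => ?_, (hcl A (h.trans (Finset.filter_subset _ _))).2 ⟨?_, hYX⟩⟩
        · have := Finset.mem_filter.1 (h he)
          exact Finset.mem_filter.2 ⟨this.1, this.2.2⟩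
        · exact fun e he => (Finset.mem_filter.1 (h he)).2.1
    rw [h1, Finset.sum_powerset_neg_one_pow_card]
    congr 1
    rw [eq_iff_iff, Finset.filter_eq_empty_iff]
    constructor
    · exact fun h => hYX.antisymm fun e he => by
        by_contra hc
        exact h (by simpa using hX.subset_ground he) ⟨he, hc⟩
    · rintro rfl e _ ⟨h1, h2⟩
      exact h2 h1
  · rw [if_neg (fun h => hYX h.subset)]
    refine Finset.sum_eq_zero fun A hA => if_neg fun h => hYX ?_
    exact ((hcl A ((Finset.mem_powerset.1 hA).trans (Finset.filter_subset _ _))).1 h).2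

-- `sum_mobius` gives a one-sided inverse of the zeta matrix; for square matrices it is two-sided.
open Classical in
theorem sum_mobius' (hY : M.IsFlat Y) (hX : M.IsFlat X) :
    (∑ Z ∈ flats M, (if Y ⊆ Z then 1 else 0) * mobius M Z X) = if Y = X then 1 else 0 := by
  classical
  let μ : Matrix (flats M) (flats M) ℤ := fun Y X => mobius M Y.1 X.1
  let ζ : Matrix (flats M) (flats M) ℤ := fun Y X => if Y.1 ⊆ X.1 then 1 else 0
  have h1 : μ * ζ = 1 := by
    ext Y X
    rw [Matrix.mul_apply, Matrix.one_apply]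
    have := sum_mobius (mem_flats.1 Y.2) (mem_flats.1 X.2)
    rw [← Finset.sum_coe_sort] at this
    simpa only [Subtype.ext_iff] using this
  have h2 := mul_eq_one_comm.1 h1
  have h3 := congrFun (congrFun h2 ⟨Y, mem_flats.2 hY⟩) ⟨X, mem_flats.2 hX⟩
  rw [Matrix.mul_apply, Matrix.one_apply] at h3
  rw [← Finset.sum_coe_sort]
  simpa only [Subtype.ext_iff] using h3

open Classical in
theorem chi_eq_sum_mobius (hY : M.IsFlat Y) (hF : M.IsFlat F) (hYF : Y ⊆ F) :
    chi M Y F = ∑ Z ∈ flats M,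
      (if Z ⊆ F then C (mobius M Y Z) * (Polynomial.X : ℤ[X]) ^ (rk M F - rk M Z) else 0) := by
  classical
  simp only [chi]
  rw [← Finset.sum_fiberwise_of_maps_to
      (g := fun A : Finset α => M.closure ((A : Set α) ∪ Y)) (t := flats M)
      (fun A _ => mem_flats.2 (M.isFlat_closure _))]
  refine Finset.sum_congr rfl fun Z _ => ?_
  have hE : ∀ A : Finset α, A ⊆ M.ground_finite.toFinset → (A : Set α) ∪ Y ⊆ M.E := by
    intro A hA
    refine Set.union_subset ?_ hY.subset_ground
    have := Finset.coe_subset.2 hA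
    rwa [Set.Finite.coe_toFinset] at this
  split_ifs with hZ
  · simp only [mobius, map_sum, Finset.sum_mul]
    refine Finset.sum_congr ?_ fun A hA => ?_
    · ext A
      simp only [Finset.mem_filter, Finset.mem_powerset]
      refine and_congr_left fun h => ⟨fun h1 e he => ?_, fun h1 e he => ?_⟩
      · have := Finset.mem_filter.1 (h1 he)
        exact Finset.mem_filter.2 ⟨this.1, this.2.2⟩
      · have := Finset.mem_filter.1 (h1 he)
        refine Finset.mem_filter.2 ⟨this.1, hZ (h ▸ ?_), this.2⟩
        exact M.subset_closure _ (hE A (h1.trans (Finset.filter_subset _ _))) (.inl he)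
    · rw [← (Finset.mem_filter.1 hA).2, rk_closure]
      simp
  · refine Finset.sum_eq_zero fun A hA => (hZ ?_).elim
    obtain ⟨h1, rfl⟩ := Finset.mem_filter.1 hA
    refine closure_subset_flat hF (Set.union_subset (fun e he => ?_) hYF)
    exact (Finset.mem_filter.1 (Finset.mem_powerset.1 h1 he)).2.1

-- Expanding `chi M Z F` in Möbius values and summing over `Z ⊇ Y` leaves only the term `W = Y`.
open Classical in
theorem sum_chi (hY : M.IsFlat Y) (hF : M.IsFlat F) (hYF : Y ⊆ F) :
    (∑ Z ∈ flats M, if Y ⊆ Z ∧ Z ⊆ F then chi M Z F else 0) =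
      (Polynomial.X : ℤ[X]) ^ (rk M F - rk M Y) := by
  classical
  have h1 : ∀ Z ∈ flats M, (if Y ⊆ Z ∧ Z ⊆ F then chi M Z F else 0) = ∑ W ∈ flats M,
      (if W ⊆ F then C ((if Y ⊆ Z then 1 else 0) * mobius M Z W) *
        (Polynomial.X : ℤ[X]) ^ (rk M F - rk M W) else 0) := by
    intro Z hZ
    by_cases hYZ : Y ⊆ Z
    · by_cases hZF : Z ⊆ F
      · rw [if_pos ⟨hYZ, hZF⟩, chi_eq_sum_mobius (mem_flats.1 hZ) hF hZF]
        simp [hYZ]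
      · rw [if_neg (fun h => hZF h.2)]
        symm
        refine Finset.sum_eq_zero fun W hW => ?_
        split_ifs with hWF
        -- The condition `Z ⊆ F` may be dropped, because `mobius M Z W` vanishes unless `Z ⊆ W`.
        · have : mobius M Z W = 0 := by
            simp only [mobius]
            refine Finset.sum_eq_zero fun A hA => (hZF ?_).elim
            obtain ⟨h1, h2⟩ := Finset.mem_filter.1 hA
            refine Set.Subset.trans ?_ hWF
            rw [← h2]
            exact M.subset_closure_of_subset' Set.subset_union_right
              (mem_flats.1 hZ).subset_ground
          simp [this]
        · rfl
    · rw [if_neg (fun h => hYZ h.1)]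
      simp [hYZ]
  rw [Finset.sum_congr rfl h1, Finset.sum_comm, Finset.sum_eq_single Y]
  · simp only [if_pos hYF]
    rw [← Finset.sum_mul, ← map_sum, sum_mobius' hY hY]
    simp
  · intro W hW hne
    by_cases hWF : W ⊆ F
    · simp only [if_pos hWF]
      rw [← Finset.sum_mul, ← map_sum, sum_mobius' hY (mem_flats.1 hW), if_neg hne.symm]
      simp
    · simp [hWF]
  · exact fun h => (h (mem_flats.2 hY)).elim

theorem chi_self (F : Set α) : chi M F F = 1 := by
  simp [chi]

end Mobius

/-! ### A sign-reversing involution on refinements of a nested set. -/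

section Toggle

variable [M.Loopless] (hG : IsFactorial M G)
include hG

theorem IsFactorial.nestedSets_subset (hT : T ∈ nestedSets M G) (h : S ⊆ T) :
    S ∈ nestedSets M G :=
  (mem_nestedSets hG).2 (((mem_nestedSets hG).1 hT).subset h)

-- Inserting a factor `A` of `Y` preserves all the bounds on `z`. Above `F` it is absorbed by `F`
-- itself; a member strictly between `A` and `F` would lie in `Y` and hence in the factor `A`.
open Classical in
theorem IsFactorial.z_insert_subset (hU : IsNested M G U) {F F' : Set α} {p : Set α}
    (hF : F ∈ U) (hF' : F' ∈ U)
    (hY : M.IsFlat Y) (hYF : Y ⊂ F) (hA : A ∈ factors G Y) (hUY : z M U F ⊆ Y)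
    (hp : M.IsFlat p) (hz : z M U F' ⊆ p) (hpF : F' = F → p = Y) : z M (insert A U) F' ⊆ p := by
  refine join_subset hp ?_
  rintro B ⟨hB, hBF'⟩
  have hUsub : ∀ B ∈ U, B ⊂ F' → B ⊆ p := fun B hB h => (hG.subset_z hU hB h).trans hz
  rcases Finset.mem_insert.1 hB with rfl | hB
  · have hBF : B ⊂ F := (factor_subset hA).trans_ssubset hYF
    have hne := hG.nonempty B (factor_mem hA)
    by_cases hFF : F' = F
    · exact hpF hFF ▸ factor_subset hA
    rcases hG.subset_or_subset hU hF hF' (hne.mono (Set.subset_inter hBF.subset hBF'.subset))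
      with h | h
    · exact hBF.subset.trans (hUsub F hF (h.ssubset_of_ne (Ne.symm hFF)))
    · refine (hBF'.not_subset ?_).elim
      refine hG.subset_factor hY hA (hU.1 hF') ?_ ?_
      · exact (hG.subset_z hU hF' (h.ssubset_of_ne hFF)).trans hUY
      · rwa [Set.inter_eq_left.2 hBF'.subset]
  · exact hUsub B hB hBF'

open Classical in
/-- Inclusion-exclusion over the nested sets that refine `W` below prescribed flats. -/
theorem IsFactorial.sum_refinements (hW : IsNested M G W) (h : factorFinset M G M.E ⊆ W)
    (p : W → Set α) (hp : ∀ F, M.IsFlat (p F) ∧ p F ⊂ F.1) :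
    (∑ U ∈ (nestedSets M G).filter (fun U => W ⊆ U ∧ ∀ F : W, z M U F ⊆ p F),
      (-1 : ℤ) ^ (U \ W).card) = if ∀ F : W, p F = z M W F then 1 else 0 := by
  split_ifs with hpz
  · rw [Finset.sum_eq_single W]
    · simp
    · intro U hU hne
      obtain ⟨hUN, hWU, hUz⟩ := Finset.mem_filter.1 hU
      rw [mem_nestedSets hG] at hUN
      exfalso
      obtain ⟨g, hgU, hgW⟩ : ∃ g ∈ U, g ∉ W := by
        by_contra! hc
        exact hne (Finset.Subset.antisymm hc hWU)
      obtain ⟨E₀, hE₀, hgE₀⟩ := hG.exists_subset_factor_ground (hUN.1 hgU)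
      -- For the smallest `F ∈ W` above `g`, the bound gives `g ⊆ z_W(F)`, so `g` lies in a smaller
      -- member of `W`.
      obtain ⟨F, -, hF⟩ := (W.filter (g ⊆ ·)).exists_le_minimal
        (Finset.mem_filter.2 ⟨h hE₀, hgE₀⟩)
      obtain ⟨hFW, hgF⟩ := Finset.mem_filter.1 hF.1
      have hgF' : g ⊂ F := hgF.ssubset_of_ne fun h => hgW (h ▸ hFW)
      have h1 : g ⊆ z M W F := by
        have h2 := hUz ⟨F, hFW⟩
        rw [hpz] at h2
        exact (hG.subset_z hUN hgU hgF').trans h2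
      rw [z_eq] at h1
      obtain ⟨A, hA, hgA⟩ := hG.exists_subset_of_subset_join (hW.subset (below_subset W F))
        (hUN.1 hgU) h1
      obtain ⟨hAW, hAF⟩ := mem_below.1 hA
      exact hAF.not_subset (hF.2 (Finset.mem_filter.2 ⟨hAW, hgA⟩) hAF.subset)
    · intro hc
      exact (hc (Finset.mem_filter.2 ⟨(mem_nestedSets hG).2 hW, subset_rfl,
        fun F => (hpz F).ge⟩)).elim
  · push Not at hpz
    obtain ⟨F, hFz⟩ := hpz
    by_cases hzp : z M W F ⊆ p F
    -- If all factors of `p F` were in `W`, their union `p F` would be contained in `z_W(F)`. Such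
    -- an `A` is what the involution toggles.
    · obtain ⟨A, hA, hAW⟩ : ∃ A ∈ factors G (p F), A ∉ W := by
        by_contra! hc
        refine hFz (Set.Subset.antisymm (fun e he => ?_) hzp)
        obtain ⟨A, hA, heA⟩ := hG.exists_mem _ (hp F).1 e he
        exact hG.subset_z hW (hc A hA) ((factor_subset hA).trans_ssubset (hp F).2) heA
      have hkey : ∀ U ∈ (nestedSets M G).filter (fun U => W ⊆ U ∧ ∀ F : W, z M U F ⊆ p F),
          insert A U ∈ (nestedSets M G).filter (fun U => W ⊆ U ∧ ∀ F : W, z M U F ⊆ p F) ∧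
          U.erase A ∈ (nestedSets M G).filter (fun U => W ⊆ U ∧ ∀ F : W, z M U F ⊆ p F) := by
        intro U hU
        obtain ⟨hUN, hWU, hUz⟩ := Finset.mem_filter.1 hU
        rw [mem_nestedSets hG] at hUN
        refine ⟨Finset.mem_filter.2 ⟨(mem_nestedSets hG).2 ?_,
          hWU.trans (Finset.subset_insert _ _), fun F' => ?_⟩,
          Finset.mem_filter.2 ⟨(mem_nestedSets hG).2 (hUN.subset (Finset.erase_subset _ _)),
          Finset.subset_erase.2 ⟨hWU, hAW⟩,
          fun F' => (z_mono (Finset.erase_subset _ _)).trans (hUz F')⟩⟩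
        · exact hG.nested_insert hUN (hWU F.2) (hp F).1 (hp F).2
            (fun u hu huF => (hG.subset_z hUN hu huF).trans (hUz F)) hA
        · exact hG.z_insert_subset hUN (hWU F.2) (hWU F'.2) (hp F).1 (hp F).2 hA (hUz F)
            (hp F').1 (hUz F') fun h => by rw [Subtype.ext h]
      refine Finset.sum_involution (fun U _ => if A ∈ U then U.erase A else insert A U)
        ?_ ?_ ?_ ?_
      · intro U hU
        by_cases hAU : A ∈ U
        · have h1 : A ∈ U \ W := Finset.mem_sdiff.2 ⟨hAU, hAW⟩
          rw [if_pos hAU, Finset.erase_sdiff_comm, ← Finset.card_erase_add_one h1, pow_succ]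
          ring
        · rw [if_neg hAU, Finset.insert_sdiff_of_notMem _ hAW, Finset.card_insert_of_notMem
            (fun h => hAU (Finset.mem_sdiff.1 h).1), pow_succ]
          ring
      · intro U hU _
        by_cases hAU : A ∈ U
        · rw [if_pos hAU]; exact fun h => Finset.notMem_erase A U (h.symm ▸ hAU)
        · rw [if_neg hAU]; exact fun h => hAU (h ▸ Finset.mem_insert_self A U)
      · intro U hU
        split_ifs
        exacts [(hkey U hU).2, (hkey U hU).1]
      · intro U hU
        by_cases hAU : A ∈ U
        · simp [hAU]
        · simp [hAU]
    · refine Finset.sum_eq_zero fun U hU => (hzp ?_).elim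
      obtain ⟨-, hWU, hUz⟩ := Finset.mem_filter.1 hU
      exact (z_mono hWU).trans (hUz F)

end Toggle

/-! ### Resummation over families of finite sets. -/

section Reindex

/-- A set `T` is recovered from `U = T ∪ S` and `V = T ∩ S`. -/
theorem sum_union_eq {β R : Type*} [DecidableEq β] [AddCommMonoid R] {N : Finset (Finset β)}
    {S : Finset β} [DecidablePred fun T => T ∪ S ∈ N] [DecidablePred (S ⊆ ·)]
    (hN : ∀ T ∈ N, ∀ T' ⊆ T, T' ∈ N) (f : Finset β → R) :
    ∑ T ∈ N.filter (fun T => T ∪ S ∈ N), f T =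
      ∑ U ∈ N.filter (S ⊆ ·), ∑ V ∈ S.powerset, f (U \ S ∪ V) := by
  rw [← Finset.sum_fiberwise_of_maps_to (g := (· ∪ S)) (t := N.filter (S ⊆ ·))
    (fun T hT => Finset.mem_filter.2 ⟨(Finset.mem_filter.1 hT).2, Finset.subset_union_right⟩)]
  refine Finset.sum_congr rfl fun U hU => ?_
  obtain ⟨hUN, hSU⟩ := Finset.mem_filter.1 hU
  refine Finset.sum_nbij' (· ∩ S) (fun V => U \ S ∪ V) ?_ ?_ ?_ ?_ ?_
  · exact fun T _ => Finset.mem_powerset.2 Finset.inter_subset_right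
  · intro V hV
    rw [Finset.mem_powerset] at hV
    have h1 : U \ S ∪ V ∪ S = U := by
      rw [Finset.union_assoc, Finset.union_eq_right.2 hV, Finset.sdiff_union_of_subset hSU]
    have h2 : U \ S ∪ V ⊆ U := Finset.union_subset Finset.sdiff_subset (hV.trans hSU)
    exact Finset.mem_filter.2 ⟨Finset.mem_filter.2 ⟨hN U hUN _ h2, by rwa [h1]⟩, h1⟩
  · intro T hT
    obtain ⟨-, rfl⟩ := Finset.mem_filter.1 hT
    ext e
    simp only [Finset.mem_union, Finset.mem_sdiff, Finset.mem_inter]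
    tauto
  · intro V hV
    rw [Finset.mem_powerset] at hV
    ext e
    simp only [Finset.mem_union, Finset.mem_sdiff, Finset.mem_inter]
    have := @hV e
    tauto
  · intro T hT
    obtain ⟨-, rfl⟩ := Finset.mem_filter.1 hT
    congr 1
    ext e
    simp only [Finset.mem_union, Finset.mem_sdiff, Finset.mem_inter]
    tauto

theorem prod_sub_indicator {β R : Type*} [DecidableEq β] [CommRing R] (S U : Finset β)
    (hSU : S ⊆ U) (x : β → R) :
    (∏ i ∈ U \ S, (x i - 1)) * ∏ i ∈ S, x i =
      ∑ W ∈ U.powerset.filter (S ⊆ ·), (-1) ^ (U \ W).card * ∏ i ∈ W, x i := by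
  have h1 : (∏ i ∈ U \ S, (x i - 1)) * ∏ i ∈ S, x i =
      ∏ i ∈ U, (x i + if i ∈ S then 0 else -1) := by
    rw [← Finset.prod_sdiff hSU]
    congr 1
    · refine Finset.prod_congr rfl fun i hi => ?_
      rw [if_neg (Finset.mem_sdiff.1 hi).2, sub_eq_add_neg]
    · refine Finset.prod_congr rfl fun i hi => ?_
      rw [if_pos hi, add_zero]
  rw [h1, Finset.prod_add, Finset.sum_filter]
  refine Finset.sum_congr rfl fun W hW => ?_
  split_ifs with hSW
  · rw [mul_comm]
    congr 1
    rw [Finset.prod_congr rfl (g := fun _ => (-1 : R)), Finset.prod_const]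
    intro i hi
    exact if_neg fun h => (Finset.mem_sdiff.1 hi).2 (hSW h)
  · obtain ⟨i, hi, hiW⟩ := Finset.not_subset.1 hSW
    have h2 : ∏ i ∈ U \ W, (if i ∈ S then (0 : R) else -1) = 0 :=
      Finset.prod_eq_zero (Finset.mem_sdiff.2 ⟨hSU hi, hiW⟩) (if_pos hi)
    rw [h2, mul_zero]

end Reindex

/-! ### The identity of Euler-Poincaré and Hilbert-Poincaré polynomials. -/

section Main

local notation "ι" => algebraMap ℤ[X] (RatFunc ℤ)

theorem ratFunc_X_sub_one_ne_zero : (RatFunc.X - 1 : RatFunc ℤ) ≠ 0 := by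
  have h : (RatFunc.X - 1 : RatFunc ℤ) = ι (Polynomial.X - 1) := by simp
  rw [h]
  exact (map_ne_zero_iff _ (RatFunc.algebraMap_injective ℤ)).2 (Polynomial.X_sub_C_ne_zero 1)

/-- The reduced characteristic polynomial of `(M | F) / Y`. -/
noncomputable def redChi (M : Matroid α) [M.Finite] (Y F : Set α) : RatFunc ℤ :=
  ι (chi M Y F) / (RatFunc.X - 1)

-- In `sum_chi` the term `Z = F` equals one; moving it to the right leaves `q^n - 1`, and dividing
-- by `q - 1` gives the `q`-integer.
open Classical in
theorem algebraMap_qNat (hY : M.IsFlat Y) (hF : M.IsFlat F) (hYF : Y ⊆ F) :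
    ι (qNat (rk M F - rk M Y)) =
      ∑ Z ∈ (flats M).filter (· ⊂ F), if Y ⊆ Z then redChi M Z F else 0 := by
  have h1 := sum_chi hY hF hYF
  have h2 : (∑ Z ∈ flats M, if Y ⊆ Z ∧ Z ⊆ F then chi M Z F else 0) =
      1 + ∑ Z ∈ (flats M).filter (· ⊂ F), if Y ⊆ Z then chi M Z F else 0 := by
    rw [← Finset.add_sum_erase _ _ (mem_flats.2 hF), if_pos ⟨hYF, subset_rfl⟩, chi_self]
    congr 1
    rw [Finset.sum_filter]
    symm
    rw [← Finset.add_sum_erase _ _ (mem_flats.2 hF), if_neg (ssubset_irrefl F), zero_add]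
    refine Finset.sum_congr rfl fun Z hZ => ?_
    have hne := (Finset.mem_erase.1 hZ).1
    by_cases h3 : Z ⊆ F
    · simp [h3, h3.ssubset_of_ne hne]
    · have h4 : ¬ Z ⊂ F := fun h => h3 h.subset
      simp [h3, h4]
  rw [h2] at h1
  have h3 : qNat (rk M F - rk M Y) * (Polynomial.X - 1) =
      ∑ Z ∈ (flats M).filter (· ⊂ F), if Y ⊆ Z then chi M Z F else 0 := by
    rw [qNat, geom_sum_mul, ← h1]
    ring
  have h4 := congrArg ι h3
  rw [map_mul, map_sum] at h4
  have h5 : ι (Polynomial.X - 1) = RatFunc.X - 1 := by simp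
  rw [h5] at h4
  rw [eq_div_of_mul_eq ratFunc_X_sub_one_ne_zero h4, Finset.sum_div]
  refine Finset.sum_congr rfl fun Z _ => ?_
  split_ifs <;> simp [redChi]

variable [M.Loopless] (hG : IsFactorial M G)
include hG

-- Each `q`-integer expands as a sum over flats `p F ⊂ F`. After exchanging sums, `sum_refinements`
-- keeps only `p = z_W`.
open Classical in
theorem IsFactorial.sum_prod_redChi (hW : IsNested M G W) (h : factorFinset M G M.E ⊆ W) :
    ∑ U ∈ (nestedSets M G).filter (W ⊆ ·), (-1) ^ (U \ W).card *
      ∏ F ∈ W, ι (qNat (rk M F - rk M (z M U F))) = ∏ F ∈ W, redChi M (z M W F) F := by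
  have hflat : ∀ F : W, M.IsFlat F.1 := fun F => hG.flat_of_nested hW F.2
  let P := Fintype.piFinset fun F : W => (flats M).filter (· ⊂ F.1)
  have hP : ∀ p, p ∈ P ↔ ∀ F, M.IsFlat (p F) ∧ p F ⊂ F.1 := fun p => by
    simp [P, Fintype.mem_piFinset, mem_flats]
  have h1 : ∀ U : Finset (Set α), ∏ F ∈ W, ι (qNat (rk M F - rk M (z M U F))) =
      ∑ p ∈ P, if ∀ F : W, z M U F ⊆ p F then ∏ F : W, redChi M (p F) F.1 else 0 := by
    intro U
    rw [← Finset.prod_coe_sort]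
    rw [Finset.prod_congr rfl fun F _ => algebraMap_qNat (isFlat_z U F.1) (hflat F)
      (z_subset (hflat F)), Finset.prod_univ_sum]
    refine Finset.sum_congr rfl fun p _ => ?_
    rw [Finset.prod_ite_zero]
    simp
  simp only [h1, Finset.mul_sum]
  rw [Finset.sum_comm]
  have h2 : ∀ p ∈ P, ∑ U ∈ (nestedSets M G).filter (W ⊆ ·), (-1 : RatFunc ℤ) ^ (U \ W).card *
      (if ∀ F : W, z M U F ⊆ p F then ∏ F : W, redChi M (p F) F.1 else 0) =
      if ∀ F : W, p F = z M W F then ∏ F : W, redChi M (p F) F.1 else 0 := by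
    intro p hp
    have h3 := congrArg (Int.cast : ℤ → RatFunc ℤ)
      (hG.sum_refinements hW h p ((hP p).1 hp))
    rw [← Finset.filter_filter, Finset.sum_filter] at h3
    push_cast at h3
    calc _ = (∑ U ∈ (nestedSets M G).filter (W ⊆ ·), if ∀ F : W, z M U F ⊆ p F then
          (-1 : RatFunc ℤ) ^ (U \ W).card else 0) * ∏ F : W, redChi M (p F) F.1 := by
            rw [Finset.sum_mul]
            refine Finset.sum_congr rfl fun U _ => ?_
            split_ifs <;> simp
      _ = _ := by
            rw [h3]
            split_ifs <;> simp
  rw [Finset.sum_congr rfl h2, Finset.sum_eq_single (fun F : W => z M W F.1)]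
  · simp only [implies_true, if_true]
    exact Finset.prod_coe_sort W fun F => redChi M (z M W F) F
  · intro p _ hne
    exact if_neg fun hc => hne (funext hc)
  · intro hc
    exact (hc ((hP _).2 fun F => ⟨isFlat_z _ _, hG.z_ssubset hW (hW.1 F.2)⟩)).elim

open Classical in
theorem IsFactorial.algebraMap_hilbertSum (h : factorFinset M G M.E ⊆ S) :
    ι (hilbertSum M G S) =
      ∑ W ∈ (nestedSets M G).filter (S ⊆ ·), ∏ F ∈ W, redChi M (z M W F) F := by
  set x : Finset (Set α) → Set α → RatFunc ℤ := fun U F => ι (qNat (rk M F - rk M (z M U F)))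
    with hx
  have h1 : ι (hilbertSum M G S) =
      ∑ T ∈ (nestedSets M G).filter (fun T => T ∪ S ∈ nestedSets M G),
        ∏ F ∈ T, (x (T ∪ S) F - 1) := by
    simp only [hilbertSum, map_sum, map_prod, map_sub, map_one, hx]
  rw [h1, sum_union_eq fun T hT T' h => hG.nestedSets_subset hT h]
  have h2 : ∀ U ∈ (nestedSets M G).filter (S ⊆ ·),
      ∑ V ∈ S.powerset, ∏ F ∈ U \ S ∪ V, (x (U \ S ∪ V ∪ S) F - 1) =
      ∑ W ∈ U.powerset.filter (S ⊆ ·), (-1) ^ (U \ W).card * ∏ F ∈ W, x U F := by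
    intro U hU
    have hSU := (Finset.mem_filter.1 hU).2
    -- Summing over `V ⊆ S` turns the factors `x - 1` for `F ∈ S` into `x`; the factors outside `S`
    -- are expanded into a signed sum over `S ⊆ W ⊆ U`.
    rw [← prod_sub_indicator S U hSU, Finset.prod_congr (s₁ := S) rfl
      (fun F _ => (by ring : x U F = (x U F - 1) + 1)), Finset.prod_add_one, Finset.mul_sum]
    refine Finset.sum_congr rfl fun V hV => ?_
    rw [Finset.mem_powerset] at hV
    have h3 : U \ S ∪ V ∪ S = U := by
      rw [Finset.union_assoc, Finset.union_eq_right.2 hV, Finset.sdiff_union_of_subset hSU]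
    rw [h3, Finset.prod_union (Finset.sdiff_disjoint.mono_right hV)]
  rw [Finset.sum_congr rfl h2, Finset.sum_comm' (t' := (nestedSets M G).filter (S ⊆ ·))
    (s' := fun W => (nestedSets M G).filter (W ⊆ ·))]
  · refine Finset.sum_congr rfl fun W hW => ?_
    obtain ⟨hWN, hSW⟩ := Finset.mem_filter.1 hW
    exact hG.sum_prod_redChi ((mem_nestedSets hG).1 hWN) (h.trans hSW)
  · intro U W
    simp only [Finset.mem_filter, Finset.mem_powerset]
    exact ⟨fun h => ⟨⟨h.1.1, h.2.1⟩, hG.nestedSets_subset h.1.1 h.2.1, h.2.2⟩,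
      fun h => ⟨⟨h.1.1, h.2.2.trans h.1.2⟩, h.1.2, h.2.2⟩⟩

open Classical in
/-- The Euler-Poincaré polynomial of a nested set equals its Hilbert-Poincaré polynomial. -/
theorem IsFactorial.eulerPoincare_eq (hS : S ∈ nestedSets M G) :
    eulerPoincare M G S = ι (hPoly M G S) := by
  set tf := factorFinset M G M.E with htf
  have htop : topFactors M G = tf := rfl
  set R := tf \ S with hR
  have hSN := (mem_nestedSets hG).1 hS
  set q1 : RatFunc ℤ := RatFunc.X - 1 with hq1
  have hq1ne : q1 ≠ 0 := ratFunc_X_sub_one_ne_zero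
  rw [hPoly, map_mul, map_pow, RatFunc.algebraMap_X, htop,
    hG.algebraMap_hilbertSum Finset.subset_union_right]
  -- Extending the summand by zero lets `T` be regrouped by `U = T ∪ R`, where `R` consists of the
  -- factors of `E` not in `S`.
  let g : Finset (Set α) → RatFunc ℤ := fun T =>
    if S ⊆ T then ι (charPoly (initialAt M T)) / q1 ^ T.card else 0
  have h1 : eulerPoincare M G S =
      ∑ T ∈ (nestedSets M G).filter (fun T => T ∪ R ∈ nestedSets M G), g T := by
    rw [eulerPoincare, Finset.sum_filter]
    refine Finset.sum_congr (Finset.filter_true_of_mem fun T hT => ?_).symm fun _ _ => rfl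
    refine hG.nestedSets_subset ((mem_nestedSets hG).2
      (hG.nested_union_top ((mem_nestedSets hG).1 hT))) ?_
    exact Finset.union_subset_union_right Finset.sdiff_subset
  rw [h1, sum_union_eq fun T hT T' h => hG.nestedSets_subset hT h]
  have h2 : ∀ U ∈ (nestedSets M G).filter (R ⊆ ·), ∑ V ∈ R.powerset, g (U \ R ∪ V) =
      if S ⊆ U then RatFunc.X ^ R.card * ∏ F ∈ U, redChi M (z M U F) F else 0 := by
    intro U hU
    obtain ⟨hUN, hRU⟩ := Finset.mem_filter.1 hU
    have hUn := (mem_nestedSets hG).1 hUN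
    have hSR : Disjoint S R := Finset.disjoint_sdiff
    have hiff : ∀ V ⊆ R, S ⊆ U \ R ∪ V ↔ S ⊆ U := by
      refine fun V hV => ⟨fun h => h.trans (Finset.union_subset Finset.sdiff_subset
        (hV.trans hRU)), fun h e he => ?_⟩
      exact Finset.mem_union_left _ (Finset.mem_sdiff.2 ⟨h he, Finset.disjoint_left.1 hSR he⟩)
    split_ifs with hSU
    · have htU : tf ⊆ U := fun e he => by
        by_cases heS : e ∈ S
        · exact hSU heS
        · exact hRU (Finset.mem_sdiff.2 ⟨he, heS⟩)
      have h3 : ∀ V ∈ R.powerset, g (U \ R ∪ V) =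
          (∏ F ∈ U, redChi M (z M U F) F) * (1 ^ V.card * q1 ^ (R.card - V.card)) := by
        intro V hV
        rw [Finset.mem_powerset] at hV
        have hsub : U \ R ∪ V ⊆ U := Finset.union_subset Finset.sdiff_subset (hV.trans hRU)
        have hunion : U \ R ∪ V ∪ tf = U := by
          refine (Finset.union_subset hsub htU).antisymm fun e he => ?_
          by_cases heR : e ∈ R
          · exact Finset.mem_union_right _ (Finset.mem_sdiff.1 heR).1
          · exact Finset.mem_union_left _ (Finset.mem_union_left _ (Finset.mem_sdiff.2 ⟨he, heR⟩))
        have hM : charPoly (initialAt M (U \ R ∪ V)) = ∏ F ∈ U, chi M (z M U F) F := by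
          rw [← hG.charPoly_initialAt hUn htU]
          have h4 := hG.initialAt_union_top (hUn.subset hsub)
          rw [← htf, hunion] at h4
          congr 1
          exact h4.symm
        have hcard : (U \ R ∪ V).card + (R.card - V.card) = U.card := by
          rw [Finset.card_union_of_disjoint (Finset.sdiff_disjoint.mono_right hV),
            Finset.card_sdiff_of_subset hRU]
          have := Finset.card_le_card hV
          have := Finset.card_le_card hRU
          omega
        simp only [g]
        rw [if_pos ((hiff V hV).2 hSU), hM, map_prod]
        simp only [redChi]
        rw [Finset.prod_div_distrib, Finset.prod_const, ← hq1, ← hcard, one_pow, one_mul, pow_add]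
        field_simp
      -- The binomial theorem gives `∑_V (q-1)^(#R - #V) = q^#R` over `V ⊆ R`.
      rw [Finset.sum_congr rfl h3, ← Finset.mul_sum, Finset.sum_pow_mul_eq_add_pow, hq1]
      ring
    · refine Finset.sum_eq_zero fun V hV => if_neg ?_
      rwa [hiff V (Finset.mem_powerset.1 hV)]
  rw [Finset.sum_congr rfl h2, ← Finset.sum_filter, Finset.filter_filter, Finset.mul_sum]
  refine Finset.sum_congr (Finset.filter_congr fun U _ => ?_) fun _ _ => rfl
  rw [← Finset.union_subset_iff, Finset.sdiff_union_self_eq_union, Finset.union_comm]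

end Main

/-! ### Inversion over the nested set complex. -/

section MobiusInversion

theorem sum_Icc_neg_one_pow {β : Type*} [DecidableEq β] {S U : Finset β} (h : S ⊆ U) :
    ∑ T ∈ Finset.Icc S U, (-1 : ℤ) ^ (T.card - S.card) = if S = U then 1 else 0 := by
  rw [Finset.Icc_eq_image_powerset h, Finset.sum_image]
  · rw [Finset.sum_congr rfl (g := fun V => (-1 : ℤ) ^ V.card),
      Finset.sum_powerset_neg_one_pow_card]
    · congr 1
      rw [Finset.sdiff_eq_empty_iff_subset, eq_iff_iff]
      exact ⟨h.antisymm, fun h => h.ge⟩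
    · intro V hV
      rw [Finset.card_union_of_disjoint
        (Finset.disjoint_sdiff.mono_right (Finset.mem_powerset.1 hV)), Nat.add_sub_cancel_left]
  · intro V hV V' hV' hVV
    have h1 : ∀ V ∈ (U \ S).powerset, (S ∪ V) \ S = V := fun V hV => by
      rw [Finset.union_sdiff_cancel_left]
      exact Finset.disjoint_sdiff.mono_right (Finset.mem_powerset.1 hV)
    rw [← h1 V hV, ← h1 V' hV']
    exact congrArg (· \ S) hVV

open Classical in
/-- The alternating sum of the Hilbert-Poincaré polynomials over the star of `S`. -/
noncomputable def altH (M : Matroid α) [M.Finite] (G : Set (Set α)) (S : Finset (Set α)) : ℤ[X] :=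
  ∑ T ∈ (nestedSets M G).filter (S ⊆ ·), (-1) ^ (T.card - S.card) * hPoly M G T

/-- Part (1) makes `H` a sum over supersets, which the alternating sum inverts. The right side does
not mention `G`, which allows comparison across building sets. -/
theorem IsFactorial.altH_mul [M.Loopless] (hG : IsFactorial M G) (hS : S ∈ nestedSets M G) :
    altH M G S * (Polynomial.X - 1) ^ S.card = charPoly (initialAt M S) := by
  classical
  set g : Finset (Set α) → RatFunc ℤ := fun T =>
    algebraMap ℤ[X] (RatFunc ℤ) (charPoly (initialAt M T)) / (RatFunc.X - 1) ^ T.card with hg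
  have h1 : algebraMap ℤ[X] (RatFunc ℤ) (altH M G S) = g S := by
    calc _ = ∑ T ∈ (nestedSets M G).filter (S ⊆ ·), ∑ U ∈ (nestedSets M G).filter (T ⊆ ·),
          (-1) ^ (T.card - S.card) * g U := by
            simp only [altH, map_sum, map_mul, map_pow, map_neg, map_one]
            refine Finset.sum_congr rfl fun T hT => ?_
            rw [← hG.eulerPoincare_eq (Finset.mem_filter.1 hT).1, eulerPoincare, Finset.mul_sum]
      _ = ∑ U ∈ (nestedSets M G).filter (S ⊆ ·), ∑ T ∈ Finset.Icc S U,
          (-1) ^ (T.card - S.card) * g U := by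
            refine Finset.sum_comm' fun T U => ?_
            simp only [Finset.mem_filter, Finset.mem_Icc]
            exact ⟨fun h => ⟨⟨h.1.2, h.2.2⟩, h.2.1, h.1.2.trans h.2.2⟩,
              fun h => ⟨⟨hG.nestedSets_subset h.2.1 h.1.2, h.1.1⟩, h.2.1, h.1.2⟩⟩
      _ = ∑ U ∈ (nestedSets M G).filter (S ⊆ ·), if S = U then g U else 0 := by
            refine Finset.sum_congr rfl fun U hU => ?_
            have h2 := congrArg (Int.cast : ℤ → RatFunc ℤ)
              (sum_Icc_neg_one_pow (Finset.mem_filter.1 hU).2)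
            push_cast at h2
            rw [← Finset.sum_mul, h2]
            split_ifs <;> simp
      _ = g S := by
            rw [Finset.sum_ite_eq, if_pos (Finset.mem_filter.2 ⟨hS, subset_rfl⟩)]
  apply RatFunc.algebraMap_injective ℤ
  rw [map_mul, h1, map_pow, map_sub, map_one, RatFunc.algebraMap_X, hg]
  exact div_mul_cancel₀ _ (pow_ne_zero _ ratFunc_X_sub_one_ne_zero)

/-- The linear form `#F s + rk F`. -/
noncomputable def linForm (M : Matroid α) (F : Set α) : RatFunc ℚ :=
  (F.ncard : RatFunc ℚ) * RatFunc.X + (rk M F : RatFunc ℚ)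

theorem topZeta_eq : topZeta M G = ∑ S ∈ nestedSets M G,
    (((altH M G S).eval 1 : ℤ) : RatFunc ℚ) * ∏ F ∈ S, (linForm M F)⁻¹ := by
  classical
  refine Finset.sum_congr rfl fun S _ => ?_
  simp only [altH, Polynomial.eval_finsetSum, Int.cast_sum, Finset.sum_mul]
  refine Finset.sum_congr rfl fun T _ => ?_
  simp [linForm]

end MobiusInversion

/-! ### Flags of flats and independence of the building set. -/

section Flags

theorem IsSimple.loopless (h : IsSimple M) : M.Loopless := by
  rw [Matroid.loopless_iff_forall_isNonloop]
  intro e he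
  have := h e he e he
  rwa [Set.pair_eq_singleton, Matroid.indep_singleton] at this

/-- The maximal building set. -/
def nonemptyFlats (M : Matroid α) : Set (Set α) := {F | M.IsFlat F ∧ F.Nonempty}

theorem factors_nonemptyFlats (hX : M.IsFlat X) (hne : X.Nonempty) :
    factors (nonemptyFlats M) X = {X} := by
  ext A
  constructor
  · intro hA
    exact (factor_subset hA).antisymm
      (Maximal.le_of_ge (P := fun Y => Y ∈ nonemptyFlats M ∧ Y ⊆ X) hA
        ⟨⟨hX, hne⟩, subset_rfl⟩ (factor_subset hA))
  · rintro rfl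
    exact ⟨⟨⟨hX, hne⟩, subset_rfl⟩, fun B hB _ => hB.2⟩

theorem isFactorial_nonemptyFlats (M : Matroid α) [M.Finite] : IsFactorial M (nonemptyFlats M) := by
  have hempty : factors (nonemptyFlats M) ∅ = ∅ := by
    refine Set.eq_empty_of_forall_notMem fun A hA => ?_
    exact (factor_mem hA).2.ne_empty (Set.subset_empty_iff.1 (factor_subset hA))
  refine ⟨fun F h => h.1, fun F h => h.2, fun X hX e he => ?_, fun X hX A hA B hB e _ _ => ?_,
    fun X hX => ?_⟩
  · rw [factors_nonemptyFlats hX ⟨e, he⟩]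
    exact ⟨X, rfl, he⟩
  · rcases X.eq_empty_or_nonempty with rfl | hne
    · rw [hempty] at hA; exact hA.elim
    · rw [factors_nonemptyFlats hX hne] at hA hB
      exact hA.trans hB.symm
  · rcases X.eq_empty_or_nonempty with rfl | hne
    · simp [factorFinset, hempty, rk_empty]
    · have : factorFinset M (nonemptyFlats M) X = {X} := by
        ext A
        simp only [factorFinset, factors_nonemptyFlats hX hne, Finset.mem_filter, mem_flats,
          Set.mem_singleton_iff, Finset.mem_singleton, and_iff_right_iff_imp]
        exact fun h => h ▸ hX
      rw [this, Finset.sum_singleton]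

theorem isNested_nonemptyFlats : IsNested M (nonemptyFlats M) c ↔
    (∀ F ∈ c, M.IsFlat F ∧ F.Nonempty) ∧ ∀ A ∈ c, ∀ B ∈ c, A ⊆ B ∨ B ⊆ A := by
  classical
  constructor
  · refine fun h => ⟨fun F hF => h.1 hF, fun A hA B hB => ?_⟩
    by_contra! hc
    have hne : A ≠ B := fun h => hc.1 h.subset
    refine h.2 {A, B} ?_ (Finset.card_pair hne).ge ?_ ⟨isFlat_join _, ?_⟩
    · simp [Finset.insert_subset_iff, hA, hB]
    · simp only [Finset.coe_insert, Finset.coe_singleton]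
      intro C hC D hD hne
      simp only [Set.mem_insert_iff, Set.mem_singleton_iff] at hC hD
      rcases hC with h1 | h1 <;> rcases hD with h2 | h2 <;> intro h <;>
        simp only [h1, h2] at h hne
      exacts [hne rfl, hc.1 h, hc.2 h, hne rfl]
    · refine (h.1 hA).2.mono (subset_join_of_mem ?_ (by simp))
      intro C hC
      simp only [Finset.coe_insert, Finset.coe_singleton, Set.mem_insert_iff,
        Set.mem_singleton_iff] at hC
      rcases hC with rfl | rfl
      exacts [(h.1 hA).1, (h.1 hB).1]
  · rintro ⟨h1, h2⟩
    refine ⟨fun F hF => h1 F hF, fun A hA hcard hanti => ?_⟩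
    obtain ⟨B, hB, C, hC, hne⟩ := Finset.one_lt_card.1 hcard
    rcases h2 B (hA hB) C (hA hC) with h | h
    · exact (hanti hB hC hne h).elim
    · exact (hanti hC hB hne.symm h).elim

/-- A flag of nonempty flats. -/
abbrev IsFlag (M : Matroid α) (c : Finset (Set α)) : Prop := IsNested M (nonemptyFlats M) c

theorem IsFlag.exists_top (hc : IsFlag M c) (hne : c.Nonempty) : ∃ X ∈ c, ∀ A ∈ c, A ⊆ X := by
  obtain ⟨X, hX⟩ := c.exists_maximal hne
  refine ⟨X, hX.1, fun A hA => ?_⟩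
  rcases (isNested_nonemptyFlats.1 hc).2 A hA X hX.1 with h | h
  · exact h
  · exact hX.2 hA h

theorem IsFlag.isFlat (hc : IsFlag M c) (hX : X ∈ c) : M.IsFlat X := (hc.1 hX).1

theorem IsFlag.join_ne [M.Loopless] (hc : IsFlag M c) (hX : X.Nonempty) (h : ∀ A ∈ c, A ⊂ X) :
    join M (c : Set (Set α)) ≠ X := by
  rcases c.eq_empty_or_nonempty with rfl | hne
  · simp only [join, Finset.coe_empty, Set.sUnion_empty, closure_empty_eq]
    exact hX.ne_empty.symm
  · obtain ⟨Y, hY, hYtop⟩ := hc.exists_top hne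
    rw [join_eq_of_top_mem (hc.isFlat hY) hY hYtop]
    exact (h Y hY).ne

open Classical in
/-- The members of the `G`-nested set whose cone contains the cone of the flag `c`. -/
noncomputable def carrier (M : Matroid α) [M.Finite] (G : Set (Set α)) (c : Finset (Set α)) :
    Finset (Set α) :=
  c.biUnion (factorFinset M G)

open Classical in
theorem carrier_insert : carrier M G (insert X c) = factorFinset M G X ∪ carrier M G c :=
  Finset.biUnion_insert

namespace IsFactorial

variable [M.Loopless] (hG : IsFactorial M G)
include hG

theorem join_carrier (hc : IsFlag M c) :
    join M (carrier M G c : Set (Set α)) = join M (c : Set (Set α)) := by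
  have : ⋃₀ (carrier M G c : Set (Set α)) = ⋃₀ (c : Set (Set α)) := by
    ext e
    simp only [carrier, Finset.coe_biUnion, Set.mem_sUnion, Set.mem_iUnion, Finset.mem_coe]
    constructor
    · rintro ⟨A, ⟨X, hX, hA⟩, he⟩
      exact ⟨X, hX, factor_subset ((mem_factorFinset hG).1 hA) he⟩
    · rintro ⟨X, hX, he⟩
      obtain ⟨A, hA, heA⟩ := hG.exists_mem X (hc.isFlat hX) e he
      exact ⟨A, ⟨X, hX, (mem_factorFinset hG).2 hA⟩, heA⟩
  rw [join, this, join]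

theorem mem_carrier : A ∈ carrier M G c ↔ ∃ X ∈ c, A ∈ factors G X := by
  simp [carrier, mem_factorFinset hG]

theorem isNested_carrier (hc : IsFlag M c) : IsNested M G (carrier M G c) := by
  classical
  induction hn : c.card using Nat.strong_induction_on generalizing c with
  | _ n ih =>
  rcases c.eq_empty_or_nonempty with rfl | hne
  · exact ⟨by simp [carrier], fun A hA h2 => by
      have : A = ∅ := by simpa [carrier] using hA
      simp [this] at h2⟩
  obtain ⟨X, hX, htop⟩ := hc.exists_top hne
  have h1 := ih _ (hn ▸ Finset.card_erase_lt_of_mem hX) (hc.subset (Finset.erase_subset X c)) rfl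
  rw [← Finset.insert_erase hX, carrier_insert, Finset.union_comm]
  refine hG.nested_union_factors (hc.isFlat hX) h1 fun u hu => ?_
  obtain ⟨Y, hY, hu⟩ := hG.mem_carrier.1 hu
  exact (factor_subset hu).trans (htop Y (Finset.mem_of_mem_erase hY))

-- A flag and its carrier have the same join, and removing the top flat changes the join.
open Classical in
theorem carrier_erase_ssubset (hc : IsFlag M c) (hX : X ∈ c)
    (htop : ∀ A ∈ c, A ⊆ X) : carrier M G (c.erase X) ⊂ carrier M G c := by
  refine (Finset.biUnion_subset_biUnion_of_subset_left _ (Finset.erase_subset _ _)).ssubset_of_ne ?_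
  intro h
  have hc' : IsFlag M (c.erase X) := hc.subset (Finset.erase_subset X c)
  have h1 := hG.join_carrier hc
  have h2 := hG.join_carrier hc'
  rw [show carrier M G (c.erase X) = carrier M G c from h, h1,
    join_eq_of_top_mem (hc.isFlat hX) hX htop] at h2
  refine hc'.join_ne (hc.1 hX).2 (fun A hA => ?_) h2.symm
  exact (htop A (Finset.mem_of_mem_erase hA)).ssubset_of_ne (Finset.ne_of_mem_erase hA)

theorem card_le_card_carrier (hc : IsFlag M c) : c.card ≤ (carrier M G c).card := by
  classical
  induction hn : c.card using Nat.strong_induction_on generalizing c with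
  | _ n ih =>
  rcases c.eq_empty_or_nonempty with rfl | hne
  · simp [← hn]
  obtain ⟨X, hX, htop⟩ := hc.exists_top hne
  have h1 := ih _ (hn ▸ Finset.card_erase_lt_of_mem hX) (hc.subset (Finset.erase_subset X c)) rfl
  have h2 := Finset.card_lt_card (hG.carrier_erase_ssubset hc hX htop)
  rw [Finset.card_erase_of_mem hX] at h1
  omega

/-- A base meets a flat in a basis exactly when it meets each of its factors in one. -/
theorem initialAt_carrier (hc : IsFlag M c) : initialAt M (carrier M G c) = initialAt M c := by
  refine Matroid.ext_isBase rfl fun B _ => ?_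
  rw [hG.isBase_initialAt (hG.isNested_carrier hc),
    (isFactorial_nonemptyFlats M).isBase_initialAt hc]
  refine and_congr_right fun hB => ⟨fun h X hX => ?_, fun h A hA => ?_⟩
  · exact (hG.ncard_inter_eq_iff (hc.isFlat hX) hB).2 fun A hA =>
      h A (hG.mem_carrier.2 ⟨X, hX, (mem_factorFinset hG).1 hA⟩)
  · obtain ⟨X, hX, hAX⟩ := hG.mem_carrier.1 hA
    exact (hG.ncard_inter_eq_iff (hc.isFlat hX) hB).1 (h X hX) A ((mem_factorFinset hG).2 hAX)

open Classical in
/-- The full-dimensional flags refining a nested set `S` subdivide its cone. -/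
theorem sum_flags {K : Type*} [Field K] (l : Set α → K)
    (hl : ∀ X, M.IsFlat X → l X = ∑ A ∈ factorFinset M G X, l A)
    (hl0 : ∀ X, M.IsFlat X → X.Nonempty → l X ≠ 0) (hS : IsNested M G S) :
    ∑ c ∈ (nestedSets M (nonemptyFlats M)).filter
      (fun c => carrier M G c = S ∧ c.card = S.card), ∏ X ∈ c, (l X)⁻¹ = ∏ F ∈ S, (l F)⁻¹ := by
  have hmax := isFactorial_nonemptyFlats M
  induction hn : S.card using Nat.strong_induction_on generalizing S with
  | _ n ih =>
  let C : Finset (Set α) → Finset (Finset (Set α)) := fun S =>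
    (nestedSets M (nonemptyFlats M)).filter fun c => carrier M G c = S ∧ c.card = S.card
  have hC : ∀ {S c}, c ∈ C S ↔ IsFlag M c ∧ carrier M G c = S ∧ c.card = S.card := fun {S c} => by
    simp only [C, Finset.mem_filter, mem_nestedSets hmax]
  rw [← hn]
  change ∑ c ∈ C S, _ = _
  rcases S.eq_empty_or_nonempty with rfl | hne
  · have : C ∅ = {∅} := by
      ext c
      rw [hC, Finset.mem_singleton]
      constructor
      · exact fun h => Finset.card_eq_zero.1 h.2.2
      · rintro rfl
        exact ⟨isNested_nonemptyFlats.2 (by simp), by simp [carrier], rfl⟩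
    simp [this]
  set X := join M (S : Set (Set α)) with hXdef
  have hX : M.IsFlat X := isFlat_join _
  have hXne : X.Nonempty := by
    obtain ⟨A, hA⟩ := hne
    exact (hG.nonempty A (hS.1 hA)).mono (hG.subset_join hS hA)
  have hfac : factorFinset M G X = maxes S := hG.factorFinset_join hS
  -- The top flat of any flag with carrier `S` must be the join of `S`.
  have htopX : ∀ c ∈ C S, X ∈ c ∧ ∀ A ∈ c, A ⊆ X := by
    intro c hc
    obtain ⟨hflag, hcar, hcard⟩ := hC.1 hc
    have hcne : c.Nonempty := by
      rw [← Finset.card_pos, hcard]; exact hne.card_pos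
    obtain ⟨Y, hY, htop⟩ := hflag.exists_top hcne
    have h1 := hG.join_carrier hflag
    rw [hcar, join_eq_of_top_mem (hflag.isFlat hY) hY htop] at h1
    rw [hXdef, h1]
    exact ⟨hY, htop⟩
  have hins : ∀ F ∈ maxes S, ∀ c ∈ C (S.erase F), X ∉ c ∧ insert X c ∈ C S := by
    intro F hF c hc
    obtain ⟨hflag, hcar, hcard⟩ := hC.1 hc
    have hFS := maxes_subset S hF
    have hXc : X ∉ c := fun h => by
      have h1 : F ∈ carrier M G c :=
        hG.mem_carrier.2 ⟨X, h, (mem_factorFinset hG).1 (hfac ▸ hF)⟩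
      rw [hcar] at h1
      exact Finset.notMem_erase F S h1
    refine ⟨hXc, hC.2 ⟨?_, ?_, ?_⟩⟩
    · refine hmax.nested_insert_of_subset hflag hX (fun u hu => ?_)
        (by rw [factors_nonemptyFlats hX hXne]; rfl)
      refine (hmax.subset_join hflag hu).trans ?_
      rw [← hG.join_carrier hflag, hcar]
      exact join_mono (Finset.coe_subset.2 (Finset.erase_subset _ _))
    · rw [carrier_insert, hfac, hcar]
      refine (Finset.union_subset (maxes_subset S) (Finset.erase_subset _ _)).antisymm
        fun e he => ?_
      by_cases heF : e = F
      · exact Finset.mem_union_left _ (heF ▸ hF)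
      · exact Finset.mem_union_right _ (Finset.mem_erase.2 ⟨heF, he⟩)
    · rw [Finset.card_insert_of_notMem hXc, hcard, Finset.card_erase_add_one hFS]
  -- Erasing `X` shrinks the carrier, but not below `#c - 1` elements, so exactly one `F` is lost.
  -- It comes only from `X`, hence is maximal in `S`.
  have herase : ∀ c ∈ C S, ∃ F ∈ maxes S, c.erase X ∈ C (S.erase F) := by
    intro c hc
    obtain ⟨hXc, htop⟩ := htopX c hc
    obtain ⟨hflag, hcar, hcard⟩ := hC.1 hc
    have hflag' := hflag.subset (Finset.erase_subset X c)
    have h1 := hG.carrier_erase_ssubset hflag hXc htop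
    have h2 := hG.card_le_card_carrier hflag'
    have h3 := Finset.card_lt_card h1
    rw [hcar] at h1 h3
    rw [Finset.card_erase_of_mem hXc, hcard] at h2
    obtain ⟨F, hF⟩ := Finset.card_eq_one.1 (show (S \ carrier M G (c.erase X)).card = 1 by
      rw [Finset.card_sdiff_of_subset h1.subset]; omega)
    have hF' := hF ▸ Finset.mem_singleton_self F
    obtain ⟨hFS, hFc⟩ := Finset.mem_sdiff.1 hF'
    have h4 : carrier M G (c.erase X) = S.erase F := by
      rw [← Finset.sdiff_singleton_eq_erase F S, ← hF, Finset.sdiff_sdiff_eq_self h1.subset]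
    refine ⟨F, ?_, hC.2 ⟨hflag', h4, ?_⟩⟩
    · rw [← hcar, ← Finset.insert_erase hXc, carrier_insert, Finset.mem_union] at hFS
      rw [← hfac]
      exact hFS.resolve_right hFc
    · rw [Finset.card_erase_of_mem hXc, Finset.card_erase_of_mem hFS, hcard]
  have hstep : ∑ c ∈ C S, ∏ Y ∈ c, (l Y)⁻¹ =
      ∑ c ∈ (maxes S).biUnion (fun F => C (S.erase F)), (l X)⁻¹ * ∏ Y ∈ c, (l Y)⁻¹ := by
    refine Finset.sum_nbij' (·.erase X) (insert X) ?_ ?_ ?_ ?_ ?_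
    · exact fun c hc => Finset.mem_biUnion.2 (herase c hc)
    · intro c hc
      obtain ⟨F, hF, hc⟩ := Finset.mem_biUnion.1 hc
      exact (hins F hF c hc).2
    · exact fun c hc => Finset.insert_erase (htopX c hc).1
    · intro c hc
      obtain ⟨F, hF, hc⟩ := Finset.mem_biUnion.1 hc
      exact Finset.erase_insert (hins F hF c hc).1
    · exact fun c hc => (Finset.mul_prod_erase c (fun Y => (l Y)⁻¹) (htopX c hc).1).symm
  have hdisj : ((maxes S : Finset (Set α)) : Set (Set α)).PairwiseDisjoint
      fun F => C (S.erase F) := by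
    intro F hF F' hF' hne
    rw [Function.onFun, Finset.disjoint_left]
    intro c hc hc'
    have h1 := (hC.1 hc).2.1.symm.trans (hC.1 hc').2.1
    have h2 : F ∈ S.erase F' := Finset.mem_erase.2 ⟨hne, maxes_subset S hF⟩
    rw [← h1] at h2
    exact Finset.notMem_erase F S h2
  rw [hstep, Finset.sum_biUnion hdisj]
  have hl0S : ∀ F ∈ S, l F ≠ 0 := fun F hF =>
    hl0 F (hG.flat_of_nested hS hF) (hG.nonempty F (hS.1 hF))
  -- By induction the flags through `S.erase F` contribute the target times `l F / l X`; these
  -- ratios add up to one because the maximal members of `S` are the factors of `X`.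
  have hterm : ∀ F ∈ maxes S, ∑ c ∈ C (S.erase F), (l X)⁻¹ * ∏ Y ∈ c, (l Y)⁻¹ =
      ((l X)⁻¹ * ∏ F ∈ S, (l F)⁻¹) * l F := by
    intro F hF
    have hFS := maxes_subset S hF
    have h1 := ih _ (hn ▸ Finset.card_erase_lt_of_mem hFS)
      (hS.subset (Finset.erase_subset F S)) rfl
    rw [← Finset.mul_sum]
    change (l X)⁻¹ * ∑ c ∈ C (S.erase F), _ = _
    rw [h1, ← Finset.mul_prod_erase S _ hFS]
    have := hl0S F hFS
    field_simp
  rw [Finset.sum_congr rfl hterm, ← Finset.mul_sum, ← hfac, ← hl X hX]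
  have := hl0 X hX hXne
  field_simp

end IsFactorial

theorem linForm_ne_zero (hX : M.IsFlat X) (hne : X.Nonempty) : linForm M X ≠ 0 := by
  have h1 : linForm M X = algebraMap ℚ[X] (RatFunc ℚ)
      (C (X.ncard : ℚ) * Polynomial.X + C (rk M X : ℚ)) := by
    simp [linForm]
  rw [h1]
  refine (map_ne_zero_iff _ (RatFunc.algebraMap_injective ℚ)).2 fun h => ?_
  have h2 := congrArg (fun p => Polynomial.coeff p 1) h
  simp only [Polynomial.coeff_add, Polynomial.coeff_C_mul, Polynomial.coeff_X_one, mul_one,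
    Polynomial.coeff_C_succ, add_zero, Polynomial.coeff_zero, Nat.cast_eq_zero] at h2
  rw [Set.ncard_eq_zero (finite_of_subset hX.subset_ground)] at h2
  exact hne.ne_empty h2

theorem IsFactorial.linForm_eq_sum [M.Loopless] (hG : IsFactorial M G) (hX : M.IsFlat X) :
    linForm M X = ∑ A ∈ factorFinset M G X, linForm M A := by
  have h1 := hG.sum_ncard_inter_factors hX hX.subset_ground
  rw [Set.inter_self] at h1
  simp only [linForm, Finset.sum_add_distrib, ← Finset.sum_mul]
  rw [← h1, ← hG.sum_rk X hX]
  push_cast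
  congr 2
  refine Finset.sum_congr rfl fun A hA => ?_
  rw [Set.inter_eq_right.2 (factor_subset ((mem_factorFinset hG).1 hA))]

/-- By `altH_mul` both alternating sums come from the same characteristic polynomial, so they differ
by `(q-1)^k`, where `k` is the excess of the carrier over the flag. -/
theorem IsFactorial.eval_altH_flag [M.Loopless] (hG : IsFactorial M G) (hc : IsFlag M c) :
    (altH M (nonemptyFlats M) c).eval 1 =
      if c.card = (carrier M G c).card then (altH M G (carrier M G c)).eval 1 else 0 := by
  have hmax := isFactorial_nonemptyFlats M
  have h1 := hmax.altH_mul ((mem_nestedSets hmax).2 hc)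
  have h2 := hG.altH_mul ((mem_nestedSets hG).2 (hG.isNested_carrier hc))
  have h3 : charPoly (initialAt M (carrier M G c)) = charPoly (initialAt M c) := by
    congr 1
    exact hG.initialAt_carrier hc
  have hle := hG.card_le_card_carrier hc
  have h0 : ((Polynomial.X : ℤ[X]) - 1) ≠ 0 := Polynomial.X_sub_C_ne_zero 1
  obtain ⟨k, hk⟩ := Nat.exists_eq_add_of_le hle
  rw [h3, ← h1, hk, pow_add, mul_comm (_ ^ c.card), ← mul_assoc] at h2
  have h4 := mul_right_cancel₀ (pow_ne_zero _ h0) h2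
  rw [← h4, hk]
  rcases k.eq_zero_or_pos with rfl | hpos
  · simp
  · rw [if_neg (by omega)]
    simp [hpos.ne']

/-- The topological zeta function agrees with the one of the maximal building set. -/
theorem IsFactorial.topZeta_eq_nonemptyFlats [M.Loopless] (hG : IsFactorial M G) :
    topZeta M G = topZeta M (nonemptyFlats M) := by
  classical
  have hmax := isFactorial_nonemptyFlats M
  rw [topZeta_eq, topZeta_eq, ← Finset.sum_fiberwise_of_maps_to (g := carrier M G)
    (s := nestedSets M (nonemptyFlats M)) (t := nestedSets M G) fun c hc =>
      (mem_nestedSets hG).2 (hG.isNested_carrier ((mem_nestedSets hmax).1 hc))]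
  refine Finset.sum_congr rfl fun S hS => ?_
  rw [← hG.sum_flags (linForm M) (fun X hX => hG.linForm_eq_sum hX)
    (fun X hX hne => linForm_ne_zero hX hne) ((mem_nestedSets hG).1 hS), Finset.mul_sum,
    ← Finset.filter_filter, Finset.sum_filter]
  refine Finset.sum_congr rfl fun c hc => ?_
  obtain ⟨hcN, rfl⟩ := Finset.mem_filter.1 hc
  rw [hG.eval_altH_flag ((mem_nestedSets hmax).1 hcN)]
  split_ifs <;> simp

end Flags
end MatroidBuilding

theorem mainTheorem12 {α : Type*} (M : Matroid α) [M.Finite] :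
    (M.Loopless → ∀ G : Set (Set α), MatroidBuilding.IsBuildingSet M G →
      ∀ S ∈ MatroidBuilding.nestedSets M G,
        MatroidBuilding.eulerPoincare M G S =
          algebraMap (Polynomial ℤ) (RatFunc ℤ) (MatroidBuilding.hPoly M G S)) ∧
    (MatroidBuilding.IsSimple M → ∀ G G' : Set (Set α),
      MatroidBuilding.IsBuildingSet M G → MatroidBuilding.IsBuildingSet M G' →
        MatroidBuilding.topZeta M G = MatroidBuilding.topZeta M G') := by
  refine ⟨fun hM G hG S hS => hG.isFactorial.eulerPoincare_eq hS, fun hM G G' hG hG' => ?_⟩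
  have := hM.loopless
  rw [hG.isFactorial.topZeta_eq_nonemptyFlats, hG'.isFactorial.topZeta_eq_nonemptyFlats]
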